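/- **Theorem 1.** Consider the affine system $\dot x=f(x)+g(x)u$, $y=h(x)$, with state $x\in\mathbb R^n$ and input and output $u,y\in\mathbb R^p$, where $f$, $h$ and the columns $g^1,\dots,g^p$ of $g$ are of class $C^\infty$, $f$ is globally Lipschitz, $f(0)=0$ and $h(0)=0$. Suppose that it has a vector relative degree $\{r_1,\dots,r_p\}$ with $r_i\in\{1,2\}$ at $x=0$, that is, $L_{g^j}L_f^kh_i(x)=0$ for all $i,j$, all $0\le k<r_i-1$ and all $x$ near $0$, and the matrix $A(x)=[L_{g^j}L_f^{r_i-1}h_i(x)]_{i,j}$ is nonsingular at $x=0$. Suppose also that the distribution $G=\mathrm{span}\{g^1,\dots,g^p\}$ is involutive in a neighbourhood of $0$. Then there are smooth local coordinates $(z,\xi_1,\xi_2,\xi_3)$ around $x=0$ (vanishing at $x=0$; the entries of $\xi_1$ are indexed by the $i$ with $r_i=1$, those of $\xi_2$ and $\xi_3$ by the $i$ with $r_i=2$) in which the system takes the normal form $$\dot z=f^*(z,\xi),\quad \dot\xi_1=a_1(z,\xi)+b_1(z,\xi)u,\quad \dot\xi_2=\xi_3,\quad \dot\xi_3=a_2(z,\xi)+b_2(z,\xi)u,\quad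 y=\begin{bmatrix}\xi_1\\ \xi_2\end{bmatrix},$$ with $a_1=[L_fh_i]_{r_i=1}$, $a_2=[L_f^2h_i]_{r_i=2}$, $b_1=[L_{g^j}h_i]_{r_i=1}$, $b_2=[L_{g^j}L_fh_i]_{r_i=2}$, and there is an open neighbourhood $U$ of $0$ in the domain of these coordinates on which $A(x)$ is nonsingular, such that the following holds. Let $V_1(\xi_1)$ and $V_2(\xi_2)$ be any positive semidefinite functions of class $C^1$, let $\lambda\in\mathbb R$, and apply the state feedback $$u=A(x)^{-1}\left(v-\begin{bmatrix}L_f^{r_1}h_1(x)\\ \vdots\\ L_f^{r_p}h_p(x)\end{bmatrix}-\begin{bmatrix}\nabla V_1(\xi_1)\\ \nabla V_2(\xi_2)+\lambda\xi_3\end{bmatrix}\right)$$ with new input $v\in\mathbb R^p$ (the two blocks of the last vector are the entries with $r_i=1$ and with $r_i=2$). * If $\lambda\ge0$, the resulting system with input $v$ and output $y$ is nonlinear negative imaginary (NI) on $U$: there is a function $V$ of class $C^1$ on $U$, with $V\ge0$ on $U$ and $V(0)=0$, such that $\dot V\le v^T\dot y$ along every trajectory in $U$. * If $\lambda>0$,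 it is nonlinear output strictly negative imaginary (OSNI) on $U$: there are such a $V$ and an $\epsilon>0$ with $\dot V\le v^T\dot y-\epsilon\|\dot y\|^2$ along every trajectory in $U$. In both cases $V=V_1(\xi_1)+V_2(\xi_2)+\tfrac12\|\xi_3\|^2$ is such a storage function. -/

import Mathlib

open Set Topology
open scoped ContDiff Matrix

noncomputable section

/-! ### Affine control systems -/

/-- The data of an affine system `ẋ = f(x) + g(x) u`, `y = h(x)` with state in `ℝⁿ` and input and
output in `ℝᵖ`; `g j` is the `j`-th column of the input matrix. -/
structure AffineSystem (n p : ℕ) where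
  f : EuclideanSpace ℝ (Fin n) → EuclideanSpace ℝ (Fin n)
  g : Fin p → EuclideanSpace ℝ (Fin n) → EuclideanSpace ℝ (Fin n)
  h : EuclideanSpace ℝ (Fin n) → EuclideanSpace ℝ (Fin p)

/-- The Lie derivative `L_X φ (x) = Dφ(x) X(x)` of a scalar function along a vector field. -/
def lieDeriv {n : ℕ} (X : EuclideanSpace ℝ (Fin n) → EuclideanSpace ℝ (Fin n))
    (φ : EuclideanSpace ℝ (Fin n) → ℝ) (x : EuclideanSpace ℝ (Fin n)) : ℝ :=
  fderiv ℝ φ x (X x)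

/-- A distribution `x ↦ D x` is involutive on the open set `W` if the Lie bracket of any two smooth
vector fields on `W` that belong to `D` belongs to `D`. -/
def InvolutiveOn {n : ℕ} (D : EuclideanSpace ℝ (Fin n) → Submodule ℝ (EuclideanSpace ℝ (Fin n)))
    (W : Set (EuclideanSpace ℝ (Fin n))) : Prop :=
  ∀ X Y : EuclideanSpace ℝ (Fin n) → EuclideanSpace ℝ (Fin n),
    ContDiffOn ℝ ∞ X W → ContDiffOn ℝ ∞ Y W →
    (∀ x ∈ W, X x ∈ D x) → (∀ x ∈ W, Y x ∈ D x) →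
    ∀ x ∈ W, VectorField.lieBracket ℝ X Y x ∈ D x

namespace AffineSystem

variable {n p : ℕ}

/-- The right-hand side `f(x) + g(x) u`. -/
def dyn (S : AffineSystem n p) (x : EuclideanSpace ℝ (Fin n)) (u : EuclideanSpace ℝ (Fin p)) :
    EuclideanSpace ℝ (Fin n) :=
  S.f x + ∑ j, u j • S.g j x

/-- The repeated Lie derivative `L_f^k h_i`. -/
def lieOut (S : AffineSystem n p) (k : ℕ) (i : Fin p) : EuclideanSpace ℝ (Fin n) → ℝ :=
  (lieDeriv S.f)^[k] (fun x => S.h x i)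

/-- The matrix `A(x)` whose `(i, j)` entry is `L_{g^j} L_f^{r_i - 1} h_i (x)`. -/
def decoupling (S : AffineSystem n p) (r : Fin p → ℕ) (x : EuclideanSpace ℝ (Fin n)) :
    Matrix (Fin p) (Fin p) ℝ :=
  Matrix.of fun i j => lieDeriv (S.g j) (S.lieOut (r i - 1) i) x

/-- The system has vector relative degree `{r_1, …, r_p}` (with all `r_i ≥ 1`) at `x₀`. -/
structure HasVectorRelativeDegree (S : AffineSystem n p) (r : Fin p → ℕ)
    (x₀ : EuclideanSpace ℝ (Fin n)) : Prop where
  one_le : ∀ i, 1 ≤ r i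
  eventually_eq_zero : ∀ᶠ x in 𝓝 x₀, ∀ i j, ∀ k : ℕ, k + 1 < r i →
    lieDeriv (S.g j) (S.lieOut k i) x = 0
  nonsingular : IsUnit (S.decoupling r x₀).det

/-- The distribution `G(x) = span {g^1(x), …, g^p(x)}`. -/
def inputDistribution (S : AffineSystem n p) (x : EuclideanSpace ℝ (Fin n)) :
    Submodule ℝ (EuclideanSpace ℝ (Fin n)) :=
  Submodule.span ℝ (range fun j => S.g j x)

end AffineSystem

/-! ### Nonlinear negative imaginary systems, on an open set of states -/

/-- `x` is a trajectory in `U`, on the time interval `[0, T)`, of `ẋ = F(x, u)` for the input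
signal `u`. -/
structure IsTrajectoryOn {n p : ℕ}
    (F : EuclideanSpace ℝ (Fin n) → EuclideanSpace ℝ (Fin p) → EuclideanSpace ℝ (Fin n))
    (U : Set (EuclideanSpace ℝ (Fin n))) (T : ℝ)
    (u : ℝ → EuclideanSpace ℝ (Fin p)) (x : ℝ → EuclideanSpace ℝ (Fin n)) : Prop where
  mem : ∀ t ∈ Ico 0 T, x t ∈ U
  hasDeriv : ∀ t ∈ Ico 0 T, HasDerivWithinAt x (F (x t) (u t)) (Ico 0 T) t

/-- Positive semidefiniteness of a function on a set of states. -/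
def PosSemidefOn {E : Type*} [Zero E] (V : E → ℝ) (U : Set E) : Prop :=
  V 0 = 0 ∧ ∀ x ∈ U, 0 ≤ V x

/-- `V` is a positive semidefinite `C¹` function on `U` with `V̇ ≤ uᵀ ẏ - ε ‖ẏ‖²` along every
trajectory in `U` of the system `ẋ = F(x, u)`, `y = h(x)`. -/
structure IsDissipativeStorageOn {n p : ℕ}
    (F : EuclideanSpace ℝ (Fin n) → EuclideanSpace ℝ (Fin p) → EuclideanSpace ℝ (Fin n))
    (h : EuclideanSpace ℝ (Fin n) → EuclideanSpace ℝ (Fin p))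
    (U : Set (EuclideanSpace ℝ (Fin n))) (ε : ℝ) (V : EuclideanSpace ℝ (Fin n) → ℝ) : Prop where
  contDiffOn : ContDiffOn ℝ 1 V U
  posSemidef : PosSemidefOn V U
  dissipation : ∀ (T : ℝ) (u : ℝ → EuclideanSpace ℝ (Fin p)) (x : ℝ → EuclideanSpace ℝ (Fin n)),
    IsTrajectoryOn F U T u x → ∀ t ∈ Ico 0 T,
      derivWithin (fun s => V (x s)) (Ico 0 T) t ≤
        inner ℝ (u t) (derivWithin (fun s => h (x s)) (Ico 0 T) t)
          - ε * ‖derivWithin (fun s => h (x s)) (Ico 0 T) t‖ ^ 2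

/-- `V` is a storage function of the nonlinear NI system `ẋ = F(x, u)`, `y = h(x)` on `U`:
`V̇ ≤ uᵀ ẏ`. -/
def IsNIStorageOn {n p : ℕ}
    (F : EuclideanSpace ℝ (Fin n) → EuclideanSpace ℝ (Fin p) → EuclideanSpace ℝ (Fin n))
    (h : EuclideanSpace ℝ (Fin n) → EuclideanSpace ℝ (Fin p))
    (U : Set (EuclideanSpace ℝ (Fin n))) (V : EuclideanSpace ℝ (Fin n) → ℝ) : Prop :=
  IsDissipativeStorageOn F h U 0 V

/-- `V` is a storage function of the nonlinear OSNI system `ẋ = F(x, u)`, `y = h(x)` on `U`: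
`V̇ ≤ uᵀ ẏ - ε ‖ẏ‖²` for some `ε > 0`. -/
def IsOSNIStorageOn {n p : ℕ}
    (F : EuclideanSpace ℝ (Fin n) → EuclideanSpace ℝ (Fin p) → EuclideanSpace ℝ (Fin n))
    (h : EuclideanSpace ℝ (Fin n) → EuclideanSpace ℝ (Fin p))
    (U : Set (EuclideanSpace ℝ (Fin n))) (V : EuclideanSpace ℝ (Fin n) → ℝ) : Prop :=
  ∃ ε : ℝ, 0 < ε ∧ IsDissipativeStorageOn F h U ε V

/-- The system is nonlinear NI on `U`. -/
def IsNonlinearNIOn {n p : ℕ}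
    (F : EuclideanSpace ℝ (Fin n) → EuclideanSpace ℝ (Fin p) → EuclideanSpace ℝ (Fin n))
    (h : EuclideanSpace ℝ (Fin n) → EuclideanSpace ℝ (Fin p))
    (U : Set (EuclideanSpace ℝ (Fin n))) : Prop :=
  ∃ V, IsNIStorageOn F h U V

/-- The system is nonlinear OSNI on `U`. -/
def IsNonlinearOSNIOn {n p : ℕ}
    (F : EuclideanSpace ℝ (Fin n) → EuclideanSpace ℝ (Fin p) → EuclideanSpace ℝ (Fin n))
    (h : EuclideanSpace ℝ (Fin n) → EuclideanSpace ℝ (Fin p))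
    (U : Set (EuclideanSpace ℝ (Fin n))) : Prop :=
  ∃ V, IsOSNIStorageOn F h U V

/-! ### The normal form -/

/-- The space of normal form states `(z, ξ₁, ξ₂, ξ₃)`: `z ∈ ℝᵐ`, the entries of `ξ₁` correspond to
the indices with `r_i = 1`, those of `ξ₂` and `ξ₃` to the indices with `r_i = 2`. -/
abbrev NormalState {p : ℕ} (m : ℕ) (r : Fin p → ℕ) : Type :=
  EuclideanSpace ℝ (Fin m) × EuclideanSpace ℝ {i : Fin p // r i = 1} ×
    EuclideanSpace ℝ {i : Fin p // r i = 2} × EuclideanSpace ℝ {i : Fin p // r i = 2}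

/-- A local normal form around `x = 0` of a system with relative degrees `r_i ∈ {1, 2}`: a smooth
change of coordinates `x ↦ (z, ξ₁, ξ₂, ξ₃)` on a neighbourhood of `0` (the source of `Φ`), mapping
`0` to `0`, in which the system reads
`ż = f*(z, ξ)`, `ξ̇₁ = a₁(z, ξ) + b₁(z, ξ) u`, `ξ̇₂ = ξ₃`, `ξ̇₃ = a₂(z, ξ) + b₂(z, ξ) u`,
`y = (ξ₁, ξ₂)`. -/
structure NormalForm {n p : ℕ} (S : AffineSystem n p) (r : Fin p → ℕ) where
  m : ℕ
  Φ : OpenPartialHomeomorph (EuclideanSpace ℝ (Fin n)) (NormalState m r)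
  zero_mem : 0 ∈ Φ.source
  map_zero : Φ 0 = 0
  contDiffOn : ContDiffOn ℝ ∞ Φ Φ.source
  contDiffOn_symm : ContDiffOn ℝ ∞ Φ.symm Φ.target
  fstar : NormalState m r → EuclideanSpace ℝ (Fin m)
  a₁ : NormalState m r → EuclideanSpace ℝ {i : Fin p // r i = 1}
  b₁ : NormalState m r → Matrix {i : Fin p // r i = 1} (Fin p) ℝ
  a₂ : NormalState m r → EuclideanSpace ℝ {i : Fin p // r i = 2}
  b₂ : NormalState m r → Matrix {i : Fin p // r i = 2} (Fin p) ℝ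
  /-- the system equations in the new coordinates -/
  dynamics : ∀ x ∈ Φ.source, ∀ u : EuclideanSpace ℝ (Fin p),
    fderiv ℝ Φ x (S.dyn x u) =
      (fstar (Φ x),
        a₁ (Φ x) + WithLp.toLp 2 (b₁ (Φ x) *ᵥ u.ofLp),
        (Φ x).2.2.2,
        a₂ (Φ x) + WithLp.toLp 2 (b₂ (Φ x) *ᵥ u.ofLp))
  output₁ : ∀ x ∈ Φ.source, ∀ i : {i : Fin p // r i = 1}, S.h x i = (Φ x).2.1 i
  output₂ : ∀ x ∈ Φ.source, ∀ i : {i : Fin p // r i = 2}, S.h x i = (Φ x).2.2.1 i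
  a₁_eq : ∀ x ∈ Φ.source, ∀ i, a₁ (Φ x) i = S.lieOut 1 i x
  a₂_eq : ∀ x ∈ Φ.source, ∀ i, a₂ (Φ x) i = S.lieOut 2 i x
  b₁_eq : ∀ x ∈ Φ.source, ∀ i j, b₁ (Φ x) i j = lieDeriv (S.g j) (S.lieOut 0 i) x
  b₂_eq : ∀ x ∈ Φ.source, ∀ i j, b₂ (Φ x) i j = lieDeriv (S.g j) (S.lieOut 1 i) x

namespace NormalForm

variable {n p : ℕ} {S : AffineSystem n p} {r : Fin p → ℕ}

/-- The coordinates `ξ₁` as a function of the original state. -/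
def ξ₁ (N : NormalForm S r) (x : EuclideanSpace ℝ (Fin n)) :
    EuclideanSpace ℝ {i : Fin p // r i = 1} := (N.Φ x).2.1

/-- The coordinates `ξ₂` as a function of the original state. -/
def ξ₂ (N : NormalForm S r) (x : EuclideanSpace ℝ (Fin n)) :
    EuclideanSpace ℝ {i : Fin p // r i = 2} := (N.Φ x).2.2.1

/-- The coordinates `ξ₃` as a function of the original state. -/
def ξ₃ (N : NormalForm S r) (x : EuclideanSpace ℝ (Fin n)) :
    EuclideanSpace ℝ {i : Fin p // r i = 2} := (N.Φ x).2.2.2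

/-- The vector with blocks `∇V₁(ξ₁)` (entries with `r_i = 1`) and `∇V₂(ξ₂) + lam ξ₃` (entries with
`r_i = 2`). -/
def shaping (N : NormalForm S r)
    (V₁ : EuclideanSpace ℝ {i : Fin p // r i = 1} → ℝ)
    (V₂ : EuclideanSpace ℝ {i : Fin p // r i = 2} → ℝ) (lam : ℝ)
    (x : EuclideanSpace ℝ (Fin n)) (i : Fin p) : ℝ :=
  if hi : r i = 1 then gradient V₁ (N.ξ₁ x) ⟨i, hi⟩
  else if hi : r i = 2 then gradient V₂ (N.ξ₂ x) ⟨i, hi⟩ + lam * N.ξ₃ x ⟨i, hi⟩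
  else 0

/-- The state feedback
`u = A(x)⁻¹ (v - [L_f^{r_i} h_i(x)]_i - [∇V₁(ξ₁); ∇V₂(ξ₂) + lam ξ₃])`, with new input `v`. -/
def feedback (N : NormalForm S r)
    (V₁ : EuclideanSpace ℝ {i : Fin p // r i = 1} → ℝ)
    (V₂ : EuclideanSpace ℝ {i : Fin p // r i = 2} → ℝ) (lam : ℝ)
    (x : EuclideanSpace ℝ (Fin n)) (v : EuclideanSpace ℝ (Fin p)) : EuclideanSpace ℝ (Fin p) :=
  WithLp.toLp 2 ((S.decoupling r x)⁻¹ *ᵥ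
    fun i => v i - S.lieOut (r i) i x - N.shaping V₁ V₂ lam x i)

/-- The right-hand side of the closed loop `ẋ = f(x) + g(x) u` under the feedback above. -/
def closedLoop (N : NormalForm S r)
    (V₁ : EuclideanSpace ℝ {i : Fin p // r i = 1} → ℝ)
    (V₂ : EuclideanSpace ℝ {i : Fin p // r i = 2} → ℝ) (lam : ℝ)
    (x : EuclideanSpace ℝ (Fin n)) (v : EuclideanSpace ℝ (Fin p)) : EuclideanSpace ℝ (Fin n) :=
  S.dyn x (N.feedback V₁ V₂ lam x v)

/-- The function `V₁(ξ₁) + V₂(ξ₂) + ½ ξ₃ᵀ ξ₃` of the state. -/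
def storage (N : NormalForm S r)
    (V₁ : EuclideanSpace ℝ {i : Fin p // r i = 1} → ℝ)
    (V₂ : EuclideanSpace ℝ {i : Fin p // r i = 2} → ℝ)
    (x : EuclideanSpace ℝ (Fin n)) : ℝ :=
  V₁ (N.ξ₁ x) + V₂ (N.ξ₂ x) + 1 / 2 * ‖N.ξ₃ x‖ ^ 2

end NormalForm

end

/-! In the normal form the feedback gives `ξ̇₁ = v₁ - ∇V₁(ξ₁)`, `ξ̇₂ = ξ₃`, `ξ̇₃ = v₂ - ∇V₂(ξ₂) - λ
ξ₃`, while `ẏ = (ξ̇₁, ξ₃)`. Substituting `∇V₁ = v₁ - ξ̇₁` and cancelling `∇V₂ · ξ₃`, the storage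
function satisfies `V̇ = vᵀẏ - ‖ξ̇₁‖² - λ‖ξ₃‖²`. Hence any `ε ≤ min 1 λ` is admissible; this is
`NormalForm.isDissipativeStorageOn_storage`.

The substance is the existence of the normal form, that is, of coordinates `z` whose derivative does
not contain `u`. Put `ψᵢ = L_f^{rᵢ-1} hᵢ`, so that `dψᵢ(gʲ)` is the nonsingular matrix `A`.
Inverting `A` yields a frame `Yⱼ` of `G` near `0` with `dψᵢ(Yⱼ) = δᵢⱼ`. Involutivity puts `[Yᵢ, Yⱼ]`
in `G`; every `dψₖ` annihilates it, so it vanishes. Flowing from `x` for unit time along `-∑ ψᵢ(x)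
Yᵢ` then defines a map `π` that is constant along the `Yⱼ`, hence along the `gʲ`, and whose
derivative at `0` is the identity on the common kernel of the `dψᵢ`
(`InvolutiveOn.exists_projection`). The projection of `π` to `ker dξ(0)` serves as `z`; the
differentials of the entries of `ξ` are independent at `0` because `A(0)` is nonsingular and `f(0) =
0`.

Smooth dependence of the flow on parameters and initial state comes from the inverse function
theorem in the Banach space of paths, applied to the integral equation. This needs the smoothness of
`γ ↦ f ∘ γ` in the sup norm. -/

noncomputable section

/-! ### Superposition operators on spaces of continuous maps -/

section Superposition

variable {K : Type*} [TopologicalSpace K] [CompactSpace K]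

/-- Pointwise evaluation of a continuous family of continuous linear maps, as a continuous bilinear
map. -/
def pointwiseApply (K : Type*) [TopologicalSpace K] [CompactSpace K]
    (E F : Type*) [NormedAddCommGroup E] [NormedSpace ℝ E]
    [NormedAddCommGroup F] [NormedSpace ℝ F] :
    C(K, E →L[ℝ] F) →L[ℝ] C(K, E) →L[ℝ] C(K, F) :=
  LinearMap.mkContinuous₂
    (LinearMap.mk₂ ℝ (fun (A : C(K, E →L[ℝ] F)) (γ : C(K, E)) =>
        (⟨fun t => A t (γ t), A.continuous.clm_apply γ.continuous⟩ : C(K, F)))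
      (fun _ _ _ => by ext; simp) (fun _ _ _ => by ext; simp)
      (fun _ _ _ => by ext; simp) (fun _ _ _ => by ext; simp)) 1
    (fun A γ => by
      refine (ContinuousMap.norm_le _ (by positivity)).2 fun t => ?_
      simp only [LinearMap.mk₂_apply, ContinuousMap.coe_mk, one_mul]
      exact ((A t).le_opNorm _).trans (mul_le_mul (A.norm_coe_le_norm t) (γ.norm_coe_le_norm t)
        (norm_nonneg _) (norm_nonneg A)))

@[simp]
theorem pointwiseApply_apply {E F : Type*} [NormedAddCommGroup E] [NormedSpace ℝ E]
    [NormedAddCommGroup F] [NormedSpace ℝ F] (A : C(K, E →L[ℝ] F)) (γ : C(K, E)) (t : K) :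
    pointwiseApply K E F A γ t = A t (γ t) := rfl

/-- The mean value inequality around each `γ t` bounds the remainder. The bound is uniform in `t`
because `η ↦ f' ∘ η` is continuous at `γ` in the sup norm. -/
theorem hasFDerivAt_comp_continuousMap {E F : Type*} [NormedAddCommGroup E] [NormedSpace ℝ E]
    [NormedAddCommGroup F] [NormedSpace ℝ F] (f : C(E, F)) (f' : C(E, E →L[ℝ] F))
    (hf : ∀ x, HasFDerivAt f (f' x) x) (γ : C(K, E)) :
    HasFDerivAt (fun γ : C(K, E) => f.comp γ) (pointwiseApply K E F (f'.comp γ)) γ := by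
  rw [hasFDerivAt_iff_isLittleO_nhds_zero, Asymptotics.isLittleO_iff]
  intro c hc
  have hcont : ContinuousAt (fun η : C(K, E) => f'.comp η) γ :=
    (ContinuousMap.continuous_postcomp f').continuousAt
  obtain ⟨δ, hδ, H⟩ := (@Metric.continuousAt_iff C(K, E) C(K, E →L[ℝ] F) _ _ _ _).1 hcont c hc
  filter_upwards [Metric.ball_mem_nhds (0 : C(K, E)) hδ] with η hη
  refine (ContinuousMap.norm_le _ (by positivity)).2 fun t => ?_
  have hηt : ‖η t‖ < δ := (η.norm_coe_le_norm t).trans_lt (by simpa using hη)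
  have hb : ∀ z ∈ Metric.ball (γ t) δ, ‖f' z - f' (γ t)‖ ≤ c := by
    intro z hz
    -- Translating the whole path by the constant `z - γ t` turns closeness of paths into closeness
    -- of the points `z` and `γ t`, with a radius independent of `t`.
    have h1 : dist (γ + ContinuousMap.const K (z - γ t)) γ < δ := by
      rw [dist_eq_norm, add_sub_cancel_left]
      refine lt_of_le_of_lt ((ContinuousMap.norm_le _ (norm_nonneg (z - γ t))).2 fun _ => le_rfl) ?_
      rwa [← dist_eq_norm]
    have h2 := (ContinuousMap.dist_apply_le_dist t).trans_lt (H h1)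
    rw [dist_eq_norm] at h2
    simpa using h2.le
  have key := (convex_ball (γ t) δ).norm_image_sub_le_of_norm_hasFDerivWithin_le'
    (f := f) (f' := f') (φ := f' (γ t)) (C := c) (x := γ t) (y := γ t + η t)
    (fun z _ => (hf z).hasFDerivWithinAt) hb (Metric.mem_ball_self hδ)
    (by simpa using hηt)
  rw [add_sub_cancel_left] at key
  exact key.trans (mul_le_mul_of_nonneg_left (η.norm_coe_le_norm t) hc.le)

/-- The derivative is again a superposition operator, by `fderiv ℝ f`, followed by a bounded linear
map. The induction therefore has to range over all target spaces `F`. -/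
theorem contDiff_comp_continuousMap {E : Type} [NormedAddCommGroup E] [NormedSpace ℝ E] (n : ℕ) :
    ∀ {F : Type} [NormedAddCommGroup F] [NormedSpace ℝ F] (f : C(E, F)), ContDiff ℝ n f →
      ContDiff ℝ n (fun γ : C(K, E) => f.comp γ) := by
  induction n with
  | zero =>
    intro F _ _ f _
    exact contDiff_zero.2 (ContinuousMap.continuous_postcomp f)
  | succ n ih =>
    intro F _ _ f hf
    have hf' : ContDiff ℝ n (fderiv ℝ f) := hf.fderiv_right (by norm_cast)
    have hd : Differentiable ℝ f := hf.differentiable (by simp)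
    refine (contDiff_succ_iff_hasFDerivAt (n := n)).2
      ⟨fun γ => pointwiseApply K E F ((⟨fderiv ℝ f, hf'.continuous⟩ : C(E, E →L[ℝ] F)).comp γ),
        ContDiff.continuousLinearMap_comp (pointwiseApply K E F) (ih ⟨fderiv ℝ f, hf'.continuous⟩ hf'), fun γ => ?_⟩
    exact hasFDerivAt_comp_continuousMap f ⟨fderiv ℝ f, hf'.continuous⟩
      (fun x => (hd x).hasFDerivAt) γ

end Superposition

/-! ### The integral operator on the unit interval -/

section Integral

variable {E : Type*} [NormedAddCommGroup E]

/-- The constant extension to the real line of a path parametrized by the unit interval. -/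
def pathExtend (γ : C(unitInterval, E)) (t : ℝ) : E := γ (projIcc 0 1 zero_le_one t)

theorem continuous_pathExtend (γ : C(unitInterval, E)) : Continuous (pathExtend γ) :=
  γ.continuous.comp continuous_projIcc

theorem norm_pathExtend_le (γ : C(unitInterval, E)) (t : ℝ) : ‖pathExtend γ t‖ ≤ ‖γ‖ :=
  γ.norm_coe_le_norm _

theorem pathExtend_coe (γ : C(unitInterval, E)) (t : unitInterval) : pathExtend γ t = γ t := by
  simp [pathExtend]

variable [NormedSpace ℝ E]

/-- The operator `γ ↦ (t ↦ ∫₀ᵗ γ)`. -/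
def pathIntegral (E : Type*) [NormedAddCommGroup E] [NormedSpace ℝ E] :
    C(unitInterval, E) →L[ℝ] C(unitInterval, E) :=
  LinearMap.mkContinuous
    { toFun := fun γ => ⟨fun t => ∫ u in (0 : ℝ)..t, pathExtend γ u,
        (intervalIntegral.continuous_primitive
          (fun _ _ => (continuous_pathExtend γ).intervalIntegrable _ _) 0).comp
          continuous_subtype_val⟩
      map_add' := fun γ η => by
        ext t
        exact intervalIntegral.integral_add ((continuous_pathExtend γ).intervalIntegrable _ _)
          ((continuous_pathExtend η).intervalIntegrable _ _)
      map_smul' := fun c γ => by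
        ext t
        exact intervalIntegral.integral_smul c _ } 1
    (fun γ => by
      refine (ContinuousMap.norm_le _ (by positivity)).2 fun t => ?_
      refine (intervalIntegral.norm_integral_le_of_norm_le_const
        (fun u _ => norm_pathExtend_le γ u)).trans ?_
      rw [one_mul, sub_zero, abs_of_nonneg t.2.1]
      exact mul_le_of_le_one_right (norm_nonneg _) t.2.2)

theorem pathIntegral_apply (γ : C(unitInterval, E)) (t : unitInterval) :
    pathIntegral E γ t = ∫ u in (0 : ℝ)..t, pathExtend γ u := rfl

end Integral

/-! ### Local diffeomorphisms -/

/-- The inverse is smooth wherever the derivative of `f` is invertible. Invertibility is an open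
condition, so shrinking the source makes the inverse smooth on the whole target. -/
theorem exists_openPartialHomeomorph_contDiffOn {E F : Type*} [NormedAddCommGroup E]
    [NormedSpace ℝ E] [CompleteSpace E] [NormedAddCommGroup F] [NormedSpace ℝ F]
    {f : E → F} {a : E} {f' : E ≃L[ℝ] F} {s : Set E} (hs : s ∈ 𝓝 a)
    (hf : ContDiffOn ℝ ∞ f s) (hf' : HasFDerivAt f (f' : E →L[ℝ] F) a) :
    ∃ e : OpenPartialHomeomorph E F, ⇑e = f ∧ a ∈ e.source ∧ e.source ⊆ s ∧
      ContDiffOn ℝ ∞ e e.source ∧ ContDiffOn ℝ ∞ e.symm e.target := by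
  have hfa : ContDiffAt ℝ ∞ f a := hf.contDiffAt hs
  set e₀ := hfa.toOpenPartialHomeomorph f hf' (by simp) with he₀
  have hcont : ContinuousAt (fderiv ℝ f) a := hfa.continuousAt_fderiv (by simp)
  have hU : ∀ᶠ x in 𝓝 a, fderiv ℝ f x ∈ range ((↑) : (E ≃L[ℝ] F) → E →L[ℝ] F) :=
    hcont ((ContinuousLinearEquiv.isOpen (𝕜 := ℝ) (E := E) (F := F)).mem_nhds
      ⟨f', hf'.fderiv.symm⟩)
  obtain ⟨V, hV, hVo, haV⟩ := eventually_nhds_iff.1 (hU.and hs)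
  have hsrc : (e₀.restr V).source = e₀.source ∩ V := by
    rw [OpenPartialHomeomorph.restr_source, hVo.interior_eq]
  refine ⟨e₀.restr V, rfl, ?_, ?_, ?_, ?_⟩
  · rw [hsrc]; exact ⟨hfa.mem_toOpenPartialHomeomorph_source hf' (by simp), haV⟩
  · rw [hsrc]; exact fun x hx => (hV x hx.2).2
  · exact hf.mono (by rw [hsrc]; exact fun x hx => (hV x hx.2).2)
  · intro y hy
    have hx := (e₀.restr V).map_target hy
    rw [hsrc] at hx
    obtain ⟨g', hg'⟩ := (hV _ hx.2).1
    have hat : ContDiffAt ℝ ∞ f ((e₀.restr V).symm y) :=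
      hf.contDiffAt (Filter.mem_of_superset (hVo.mem_nhds hx.2) fun z hz => (hV z hz).2)
    refine (OpenPartialHomeomorph.contDiffAt_symm (f₀' := g') _ hy ?_ hat).contDiffWithinAt
    rw [hg']
    exact (hat.differentiableAt (by simp)).hasFDerivAt

/-! ### First integrals of commuting vector fields -/

/-! ### The integral equation of the flow and its linearization. -/

section Frobenius

variable {E : Type} [NormedAddCommGroup E] [NormedSpace ℝ E] {ι : Type} [Fintype ι]

/-- Constant paths, as a continuous linear map. -/
def pathConst (E : Type) [NormedAddCommGroup E] [NormedSpace ℝ E] : E →L[ℝ] C(unitInterval, E) :=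
  LinearMap.mkContinuous
    { toFun := fun x => ContinuousMap.const unitInterval x
      map_add' := fun _ _ => rfl
      map_smul' := fun _ _ => rfl } 1
    (fun x => by
      rw [one_mul]
      exact (ContinuousMap.norm_le _ (norm_nonneg x)).2 fun _ => le_rfl)

@[simp]
theorem pathConst_apply (x : E) (t : unitInterval) : pathConst E x t = x := rfl

/-- Parameters `s`, initial state `x` and path `γ`. -/
abbrev FlowSpace (ι E : Type) [Fintype ι] [NormedAddCommGroup E] [NormedSpace ℝ E] : Type :=
  (ι → ℝ) × E × C(unitInterval, E)

/-- The difference of the two sides of the integral equation `γ(t) = x + ∫₀ᵗ ∑ᵢ sᵢ Yᵢ(γ)`. -/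
def flowResidual (Y : ι → C(E, E)) (q : FlowSpace ι E) : C(unitInterval, E) :=
  q.2.2 - pathConst E q.2.1 - pathIntegral E (∑ i, q.1 i • (Y i).comp q.2.2)

/-- The derivative of `flowResidual`. -/
def flowResidualDeriv (Y : ι → C(E, E)) (Y' : ι → C(E, E →L[ℝ] E)) (q : FlowSpace ι E) :
    FlowSpace ι E →L[ℝ] C(unitInterval, E) :=
  let fst := ContinuousLinearMap.fst ℝ (ι → ℝ) (E × C(unitInterval, E))
  let snd := ContinuousLinearMap.snd ℝ (ι → ℝ) (E × C(unitInterval, E))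
  let path := (ContinuousLinearMap.snd ℝ E C(unitInterval, E)).comp snd
  path - (pathConst E).comp ((ContinuousLinearMap.fst ℝ E C(unitInterval, E)).comp snd)
    - (pathIntegral E).comp (∑ i,
      (q.1 i • (pointwiseApply unitInterval E E ((Y' i).comp q.2.2)).comp path
        + ((ContinuousLinearMap.proj i).comp fst : FlowSpace ι E →L[ℝ] ℝ).smulRight
          ((Y i).comp q.2.2)))

theorem flowResidualDeriv_apply (Y : ι → C(E, E)) (Y' : ι → C(E, E →L[ℝ] E))
    (q d : FlowSpace ι E) :
    flowResidualDeriv Y Y' q d = d.2.2 - pathConst E d.2.1 -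
      pathIntegral E (∑ i, (q.1 i • pointwiseApply unitInterval E E ((Y' i).comp q.2.2) d.2.2
        + d.1 i • (Y i).comp q.2.2)) := by
  simp [flowResidualDeriv]

theorem contDiff_flowResidual (Y : ι → C(E, E)) (hY : ∀ i, ContDiff ℝ ∞ (Y i)) :
    ContDiff ℝ ∞ (flowResidual Y) := by
  have hsup : ∀ i, ContDiff ℝ ∞ (fun q : FlowSpace ι E => (Y i).comp q.2.2) := fun i =>
    (contDiff_infty.2 fun n => contDiff_comp_continuousMap (K := unitInterval) n (Y i)
      ((hY i).of_le (by exact_mod_cast le_top))).comp (contDiff_snd.comp contDiff_snd)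
  have hcoord : ∀ i, ContDiff ℝ ∞ (fun q : FlowSpace ι E => q.1 i) := fun i =>
    (contDiff_apply ℝ ℝ i).comp contDiff_fst
  exact ((contDiff_snd.comp contDiff_snd).sub
    (ContDiff.continuousLinearMap_comp (pathConst E) (contDiff_fst.comp contDiff_snd))).sub
    (ContDiff.continuousLinearMap_comp (pathIntegral E)
      (ContDiff.sum fun i _ => (hcoord i).smul (hsup i)))

theorem hasFDerivAt_flowResidual (Y : ι → C(E, E)) (Y' : ι → C(E, E →L[ℝ] E))
    (hY : ∀ i x, HasFDerivAt (Y i) (Y' i x) x) (q : FlowSpace ι E) :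
    HasFDerivAt (flowResidual Y) (flowResidualDeriv Y Y' q) q := by
  have hfst : HasFDerivAt (fun q : FlowSpace ι E => q.1) (ContinuousLinearMap.fst ℝ _ _) q :=
    hasFDerivAt_fst
  have hsnd : HasFDerivAt (fun q : FlowSpace ι E => q.2) (ContinuousLinearMap.snd ℝ _ _) q :=
    hasFDerivAt_snd
  have hx : HasFDerivAt (fun q : FlowSpace ι E => q.2.1)
      ((ContinuousLinearMap.fst ℝ E C(unitInterval, E)).comp (ContinuousLinearMap.snd ℝ _ _)) q :=
    hasFDerivAt_fst.comp q hsnd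
  have hγ : HasFDerivAt (fun q : FlowSpace ι E => q.2.2)
      ((ContinuousLinearMap.snd ℝ E C(unitInterval, E)).comp (ContinuousLinearMap.snd ℝ _ _)) q :=
    hasFDerivAt_snd.comp q hsnd
  have hsup := fun i => (hasFDerivAt_comp_continuousMap (K := unitInterval) (Y i) (Y' i) (hY i)
    q.2.2).comp q hγ
  have hs : ∀ i, HasFDerivAt (fun q : FlowSpace ι E => q.1 i)
      ((ContinuousLinearMap.proj i).comp (ContinuousLinearMap.fst ℝ _ _)) q := fun i =>
    (ContinuousLinearMap.proj (R := ℝ) (φ := fun _ : ι => ℝ) i).hasFDerivAt.comp q hfst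
  have hsum := HasFDerivAt.fun_sum (u := Finset.univ) fun i _ => (hs i).smul (hsup i)
  exact (hγ.sub ((pathConst E).hasFDerivAt.comp q hx)).sub
    ((pathIntegral E).hasFDerivAt.comp q hsum)

/-- For commuting vector fields, `t ↦ (1 - t) Yⱼ(γ(t))` is the variation of the solution `γ` when
the initial state moves along `Yⱼ` and the `j`-th parameter decreases at unit speed. -/
theorem flowResidualDeriv_eq_zero [CompleteSpace E] [DecidableEq ι] (Y : ι → C(E, E))
    (Y' : ι → C(E, E →L[ℝ] E)) (hY : ∀ i x, HasFDerivAt (Y i) (Y' i x) x)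
    (q : FlowSpace ι E) (hq : flowResidual Y q = 0)
    (hcomm : ∀ t i j, Y' j (q.2.2 t) (Y i (q.2.2 t)) = Y' i (q.2.2 t) (Y j (q.2.2 t))) (j : ι)
    (η : C(unitInterval, E)) (hη : ∀ t, η t = (1 - (t : ℝ)) • Y j (q.2.2 t)) :
    flowResidualDeriv Y Y' q (-Pi.single j 1, Y j q.2.1, η) = 0 := by
  obtain ⟨s, x, γ⟩ := q
  have hγ : ∀ t : unitInterval, γ t = x + ∫ u in (0 : ℝ)..t,
      pathExtend (∑ i, s i • (Y i).comp γ) u := by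
    intro t
    have h := congrArg (fun δ : C(unitInterval, E) => δ t) hq
    simp only [flowResidual, ContinuousMap.sub_apply, ContinuousMap.zero_apply, sub_sub,
      sub_eq_zero] at h
    exact h
  set X : C(unitInterval, E) := ∑ i, s i • (Y i).comp γ with hX
  -- The right-hand side of the integral equation is differentiable on the whole line and agrees
  -- with `γ` on the unit interval.
  set γe : ℝ → E := fun t => x + ∫ u in (0 : ℝ)..t, pathExtend X u with hγe
  have hγed : ∀ t, HasDerivAt γe (pathExtend X t) t := fun t =>
    ((continuous_pathExtend X).integral_hasStrictDerivAt 0 t).hasDerivAt.const_add x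
  have hγγe : ∀ t : unitInterval, γe t = γ t := fun t => (hγ t).symm
  rw [flowResidualDeriv_apply]
  ext t
  set Z : C(unitInterval, E) := ∑ i, (s i • pointwiseApply unitInterval E E ((Y' i).comp γ) η
    + (-Pi.single j 1 : ι → ℝ) i • (Y i).comp γ) with hZ
  -- Commutation replaces `Yᵢ'(Yⱼ)` by `Yⱼ'(Yᵢ)`, so the integrand becomes the derivative of `(1 -
  -- u) Yⱼ(γ(u))`.
  have hZt : ∀ u : unitInterval, Z u = (1 - (u : ℝ)) • Y' j (γ u) (X u) - Y j (γ u) := by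
    intro u
    have h1 : (∑ i, (-Pi.single j 1 : ι → ℝ) i • Y i (γ u)) = - Y j (γ u) := by
      rw [Finset.sum_eq_single j]
      · simp
      · intro b _ hb
        simp [Pi.single_eq_of_ne hb]
      · simp
    have h2 : ∀ i, Y' j (γ u) (Y i (γ u)) = Y' i (γ u) (Y j (γ u)) := fun i => hcomm u i j
    simp only [hZ, hX, ContinuousMap.sum_apply, ContinuousMap.add_apply, ContinuousMap.smul_apply,
      pointwiseApply_apply, ContinuousMap.comp_apply, Finset.sum_add_distrib, h1, hη, map_smul,
      map_sum, Finset.smul_sum, h2, sub_eq_add_neg]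
    congr 1
    exact Finset.sum_congr rfl fun i _ => smul_comm _ _ _
  have hderiv : ∀ u ∈ Ioo (0 : ℝ) t, HasDerivAt (fun u => (1 - u) • Y j (γe u))
      (pathExtend Z u) u := by
    intro u hu
    have hu' : u ∈ Icc (0 : ℝ) 1 := ⟨hu.1.le, hu.2.le.trans t.2.2⟩
    have e1 : pathExtend Z u = Z ⟨u, hu'⟩ := pathExtend_coe Z ⟨u, hu'⟩
    have e2 : pathExtend X u = X ⟨u, hu'⟩ := pathExtend_coe X ⟨u, hu'⟩
    have e3 : γe u = γ ⟨u, hu'⟩ := hγγe ⟨u, hu'⟩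
    have h1 := ((hasDerivAt_id u).const_sub 1).smul ((hY j (γe u)).comp_hasDerivAt u (hγed u))
    rw [e1, hZt, ← e3, ← e2]
    exact h1.congr_deriv (by rw [neg_one_smul, ← sub_eq_add_neg]; rfl)
  have hcont : Continuous (fun u => (1 - u) • Y j (γe u)) :=
    (continuous_const.sub continuous_id).smul ((Y j).continuous.comp
      (continuous_iff_continuousAt.2 fun u => (hγed u).continuousAt))
  have hint := intervalIntegral.integral_eq_sub_of_hasDerivAt_of_le t.2.1 hcont.continuousOn hderiv
    ((continuous_pathExtend Z).intervalIntegrable _ _)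
  have hγ0 : γe 0 = x := by simp [hγe]
  simp only [ContinuousMap.sub_apply, pathConst_apply, pathIntegral_apply, ContinuousMap.zero_apply]
  rw [hint, hη t, hγγe t, hγ0]
  simp

end Frobenius

/-! ### The smooth flow and the projection along commuting fields. -/

section FirstIntegrals

variable {E : Type} [NormedAddCommGroup E] [NormedSpace ℝ E] {ι : Type} [Fintype ι]

/-- Commuting vector fields `Yⱼ` have a smooth local flow: a family of paths `Γ(s, x)` solving the
integral equation `γ(t) = x + ∫₀ᵗ ∑ᵢ sᵢ Yᵢ(γ)`, along which the linearized equation is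
nondegenerate. -/
theorem exists_smooth_flow [CompleteSpace E] (Y : ι → C(E, E)) (Y' : ι → C(E, E →L[ℝ] E))
    (hYs : ∀ i, ContDiff ℝ ∞ (Y i)) (hY : ∀ i x, HasFDerivAt (Y i) (Y' i x) x) :
    ∃ (Γ : (ι → ℝ) × E → C(unitInterval, E)) (D : Set ((ι → ℝ) × E)), IsOpen D ∧ 0 ∈ D ∧
      ContDiffOn ℝ ∞ Γ D ∧ Γ 0 = 0 ∧
      (∀ q ∈ D, flowResidual Y (q.1, q.2, Γ q) = 0) ∧
      ∀ q ∈ D, ∀ η, flowResidualDeriv Y Y' (q.1, q.2, Γ q) (0, 0, η) = 0 → η = 0 := by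
  -- Carrying the parameters along turns the implicit equation into a local inversion problem.
  set H : FlowSpace ι E → FlowSpace ι E := fun q => (q.1, q.2.1, flowResidual Y q) with hH
  have hHs : ContDiff ℝ ∞ H :=
    contDiff_fst.prodMk ((contDiff_fst.comp contDiff_snd).prodMk (contDiff_flowResidual Y hYs))
  have hHd : ∀ q, HasFDerivAt H ((ContinuousLinearMap.fst ℝ _ _).prod
      (((ContinuousLinearMap.fst ℝ E C(unitInterval, E)).comp
        (ContinuousLinearMap.snd ℝ _ _)).prod (flowResidualDeriv Y Y' q))) q := fun q =>
    hasFDerivAt_fst.prodMk ((hasFDerivAt_fst.comp q hasFDerivAt_snd).prodMk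
      (hasFDerivAt_flowResidual Y Y' hY q))
  set c : (ι → ℝ) → C(unitInterval, E) := fun σ =>
    pathIntegral E (∑ i, σ i • pathConst E (Y i 0)) with hc
  have hc_cont : Continuous c := by
    refine (pathIntegral E).continuous.comp (continuous_finsetSum _ fun i _ => ?_)
    exact (continuous_apply i).smul continuous_const
  have hD0 : ∀ d : FlowSpace ι E,
      flowResidualDeriv Y Y' 0 d = d.2.2 - pathConst E d.2.1 - c d.1 := by
    intro d
    rw [flowResidualDeriv_apply]
    congr 2
    refine Finset.sum_congr rfl fun i _ => ?_
    ext t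
    simp
  -- At the origin `s = 0` removes the term containing `Y'`, so the derivative of `H` is triangular
  -- with identity diagonal and is inverted by changing signs.
  let L : FlowSpace ι E ≃L[ℝ] FlowSpace ι E :=
    { toFun := fun d => (d.1, d.2.1, d.2.2 - pathConst E d.2.1 - c d.1)
      map_add' := fun a b => by
        have := (flowResidualDeriv Y Y' 0).map_add a b
        simp only [hD0] at this
        exact Prod.ext rfl (Prod.ext rfl this)
      map_smul' := fun m a => by
        have := (flowResidualDeriv Y Y' 0).map_smul m a
        simp only [hD0] at this
        exact Prod.ext rfl (Prod.ext rfl this)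
      invFun := fun d => (d.1, d.2.1, d.2.2 + pathConst E d.2.1 + c d.1)
      left_inv := fun d => by
        refine Prod.ext rfl (Prod.ext rfl ?_)
        simp only
        abel
      right_inv := fun d => by
        refine Prod.ext rfl (Prod.ext rfl ?_)
        simp only
        abel
      continuous_toFun := by
        refine continuous_fst.prodMk ((continuous_fst.comp continuous_snd).prodMk ?_)
        exact ((continuous_snd.comp continuous_snd).sub ((pathConst E).continuous.comp
          (continuous_fst.comp continuous_snd))).sub (hc_cont.comp continuous_fst)
      continuous_invFun := by
        refine continuous_fst.prodMk ((continuous_fst.comp continuous_snd).prodMk ?_)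
        exact ((continuous_snd.comp continuous_snd).add ((pathConst E).continuous.comp
          (continuous_fst.comp continuous_snd))).add (hc_cont.comp continuous_fst) }
  have hL : HasFDerivAt H (L : FlowSpace ι E →L[ℝ] FlowSpace ι E) 0 := by
    convert hHd 0 using 1
    refine ContinuousLinearMap.ext fun d => ?_
    exact Prod.ext rfl (Prod.ext rfl (hD0 d).symm)
  obtain ⟨e, he, he0, -, hes, hes'⟩ :=
    exists_openPartialHomeomorph_contDiffOn Filter.univ_mem hHs.contDiffOn hL
  have hH0 : H 0 = 0 := by
    simp [hH, flowResidual]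
  set inc : (ι → ℝ) × E → FlowSpace ι E := fun q => (q.1, q.2, 0) with hinc
  have hincs : ContDiff ℝ ∞ inc := contDiff_fst.prodMk (contDiff_snd.prodMk contDiff_const)
  have hsol : ∀ q ∈ inc ⁻¹' e.target, H (e.symm (inc q)) = inc q := fun q hq => by
    rw [← he]; exact e.right_inv hq
  have hform : ∀ q ∈ inc ⁻¹' e.target, e.symm (inc q) = (q.1, q.2, (e.symm (inc q)).2.2) :=
    fun q hq => by
      have h := hsol q hq
      have h1 : (e.symm (inc q)).1 = q.1 := congrArg (fun a : FlowSpace ι E => a.1) h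
      have h2 : (e.symm (inc q)).2.1 = q.2 := congrArg (fun a : FlowSpace ι E => a.2.1) h
      exact Prod.ext h1 (Prod.ext h2 rfl)
  have h0t : (0 : FlowSpace ι E) ∈ e.target := by
    have := e.map_source he0
    rwa [he, hH0] at this
  have h0s : e.symm 0 = 0 := by
    have := e.left_inv he0
    rwa [he, hH0] at this
  refine ⟨fun q => (e.symm (inc q)).2.2, inc ⁻¹' e.target,
    e.open_target.preimage hincs.continuous, h0t, ?_, ?_, ?_, ?_⟩
  · exact (contDiff_snd.comp contDiff_snd).comp_contDiffOn
      (hes'.comp hincs.contDiffOn fun q hq => hq)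
  · change (e.symm 0).2.2 = 0
    rw [h0s]; rfl
  · intro q hq
    rw [← hform q hq]
    exact congrArg (fun a : FlowSpace ι E => a.2.2) (hsol q hq)
  -- The derivative of `e.symm` is a left inverse of that of `H`, which sends `(0, 0, η)` to zero.
  · intro q hq η hη
    rw [← hform q hq] at hη
    have h1 : HasFDerivAt e.symm (fderiv ℝ e.symm (inc q)) (H (e.symm (inc q))) := by
      rw [hsol q hq]
      exact ((hes'.contDiffAt (e.open_target.mem_nhds hq)).differentiableAt
        (by simp)).hasFDerivAt
    have h2 := h1.comp _ (hHd (e.symm (inc q)))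
    have h3 : e.symm ∘ H =ᶠ[𝓝 (e.symm (inc q))] id := by
      filter_upwards [e.open_source.mem_nhds (e.map_target hq)] with a ha
      have := e.left_inv ha
      rwa [he] at this
    have h4 := h2.unique ((hasFDerivAt_id _).congr_of_eventuallyEq h3)
    have h5 := congrArg (fun A : FlowSpace ι E →L[ℝ] FlowSpace ι E => A (0, 0, η)) h4
    simp only [ContinuousLinearMap.comp_apply, ContinuousLinearMap.prod_apply,
      ContinuousLinearMap.coe_fst', ContinuousLinearMap.coe_snd', hη,
      ContinuousLinearMap.id_apply] at h5
    have h6 : fderiv ℝ e.symm (inc q) (0 : FlowSpace ι E) = (0, 0, η) := h5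
    rw [map_zero] at h6
    exact (congrArg (fun a : FlowSpace ι E => a.2.2) h6).symm

/-- If the vector fields `Yⱼ` commute near `0` and `dψᵢ(Yⱼ) = δᵢⱼ`, then sliding along the `Yⱼ` onto
the zero set of `ψ` is a smooth local map that is constant along the `Yⱼ`. -/
theorem exists_projection_of_commuting [CompleteSpace E] [DecidableEq ι] (Y : ι → E → E)
    (hY : ∀ i, ContDiff ℝ ∞ (Y i)) (ψ : ι → E → ℝ) (hψ : ∀ i, ContDiff ℝ ∞ (ψ i))
    (hψ0 : ∀ i, ψ i 0 = 0)
    (hcomm : ∀ᶠ x in 𝓝 0, ∀ i j, VectorField.lieBracket ℝ (Y i) (Y j) x = 0)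
    (hdual : ∀ᶠ x in 𝓝 0, ∀ i j, fderiv ℝ (ψ i) x (Y j x) = if i = j then 1 else 0) :
    ∃ (π : E → E) (s : Set E), IsOpen s ∧ 0 ∈ s ∧ ContDiffOn ℝ ∞ π s ∧ π 0 = 0 ∧
      (∀ x ∈ s, ∀ j, fderiv ℝ π x (Y j x) = 0) ∧
      ∀ v, fderiv ℝ π 0 v = v - ∑ i, fderiv ℝ (ψ i) 0 v • Y i 0 := by
  set Yc : ι → C(E, E) := fun i => ⟨Y i, (hY i).continuous⟩ with hYc
  set Y' : ι → C(E, E →L[ℝ] E) := fun i =>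
    ⟨fderiv ℝ (Y i), (hY i).continuous_fderiv (by simp)⟩ with hY'
  have hYd : ∀ i x, HasFDerivAt (Yc i) (Y' i x) x := fun i x =>
    ((hY i).differentiable (by simp) x).hasFDerivAt
  obtain ⟨Γ, D, hDo, hD0, hΓ, hΓ0, hres, hinj⟩ := exists_smooth_flow Yc Y' hY hYd
  obtain ⟨ρ, hρ, hball⟩ := Metric.eventually_nhds_iff_ball.1 hcomm
  -- Moving along `Yⱼ` at unit speed raises `ψⱼ` at unit speed and fixes the other `ψᵢ`; the
  -- parameters `-ψ(x)` compensate for this.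
  set a : E → (ι → ℝ) × E := fun x => (fun i => -ψ i x, x) with ha
  have has : ContDiff ℝ ∞ a := (contDiff_pi.2 fun i => (hψ i).neg).prodMk contDiff_id
  have ha0 : a 0 = 0 := by
    simp only [ha, hψ0, neg_zero]; rfl
  set A : E → E →L[ℝ] (ι → ℝ) × E := fun x =>
    (ContinuousLinearMap.pi fun i => -fderiv ℝ (ψ i) x).prod (ContinuousLinearMap.id ℝ E) with hA
  have hAd : ∀ x, HasFDerivAt a (A x) x := fun x =>
    (hasFDerivAt_pi.2 fun i => ((hψ i).differentiable (by simp) x).hasFDerivAt.neg).prodMk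
      (hasFDerivAt_id x)
  set γ : E → C(unitInterval, E) := fun x => Γ (a x) with hγ
  have hs₁o : IsOpen (a ⁻¹' D) := hDo.preimage has.continuous
  have hγs : ContDiffOn ℝ ∞ γ (a ⁻¹' D) := hΓ.comp has.contDiffOn fun x hx => hx
  have h0s₁ : (0 : E) ∈ a ⁻¹' D := by rw [mem_preimage, ha0]; exact hD0
  have hγ0 : γ 0 = 0 := by simp only [hγ, ha0, hΓ0]
  have hγd : ∀ x ∈ a ⁻¹' D, HasFDerivAt γ (fderiv ℝ γ x) x := fun x hx =>
    ((hγs.contDiffAt (hs₁o.mem_nhds hx)).differentiableAt (by simp)).hasFDerivAt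
  -- This is the integral equation for `γ x`, differentiated with respect to `x`.
  have hvar : ∀ x ∈ a ⁻¹' D, ∀ v, flowResidualDeriv Yc Y' ((a x).1, (a x).2, γ x)
      ((A x v).1, (A x v).2, fderiv ℝ γ x v) = 0 := by
    intro x hx v
    have h1 : HasFDerivAt (fun x => (((a x).1, (a x).2, γ x) : FlowSpace ι E))
        (((ContinuousLinearMap.fst ℝ _ _).comp (A x)).prod
          (((ContinuousLinearMap.snd ℝ _ _).comp (A x)).prod (fderiv ℝ γ x))) x :=
      (hasFDerivAt_fst.comp x (hAd x)).prodMk ((hasFDerivAt_snd.comp x (hAd x)).prodMk (hγd x hx))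
    have h2 := (hasFDerivAt_flowResidual Yc Y' hYd _).comp x h1
    have h3 : (flowResidual Yc ∘ fun x => (((a x).1, (a x).2, γ x) : FlowSpace ι E))
        =ᶠ[𝓝 x] fun _ => 0 := by
      filter_upwards [hs₁o.mem_nhds hx] with y hy
      exact hres _ hy
    have h4 := h2.unique ((hasFDerivAt_const (0 : C(unitInterval, E)) x).congr_of_eventuallyEq h3)
    exact congrArg (fun B : E →L[ℝ] C(unitInterval, E) => B v) h4
  set s : Set E := (a ⁻¹' D ∩ γ ⁻¹' Metric.ball 0 ρ) ∩ interior {x | ∀ i j,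
    fderiv ℝ (ψ i) x (Y j x) = if i = j then 1 else 0} with hs
  have hev : ∀ t : unitInterval, ∀ x ∈ a ⁻¹' D,
      HasFDerivAt (fun x => γ x t) ((ContinuousMap.evalCLM ℝ t).comp (fderiv ℝ γ x)) x :=
    fun t x hx => ((ContinuousMap.evalCLM ℝ t :
      C(unitInterval, E) →L[ℝ] E).hasFDerivAt).comp x (hγd x hx)
  refine ⟨fun x => γ x 1, s, ?_, ?_, ?_, ?_, ?_, ?_⟩
  · exact (hγs.continuousOn.isOpen_inter_preimage hs₁o Metric.isOpen_ball).inter isOpen_interior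
  · refine ⟨⟨h0s₁, ?_⟩, mem_interior_iff_mem_nhds.2 hdual⟩
    rw [mem_preimage, hγ0]
    exact Metric.mem_ball_self hρ
  · exact ContDiffOn.continuousLinearMap_comp (ContinuousMap.evalCLM ℝ 1 : C(unitInterval, E) →L[ℝ] E)
      (hγs.mono fun x hx => hx.1.1)
  · simp only [hγ0]; rfl
  · intro x hx j
    have hγρ : ∀ t, γ x t ∈ Metric.ball (0 : E) ρ := fun t => by
      have h1 : ‖γ x‖ < ρ := by simpa using hx.1.2
      simpa using ((γ x).norm_coe_le_norm t).trans_lt h1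
    have hdx := interior_subset hx.2
    have hAY : A x (Y j x) = (-Pi.single j 1, Y j x) := by
      refine Prod.ext (funext fun i => ?_) rfl
      simp [hA, hdx i j, Pi.single_apply]
    set η₀ : C(unitInterval, E) := ⟨fun t => (1 - (t : ℝ)) • Y j (γ x t),
      (continuous_const.sub continuous_subtype_val).smul
        ((hY j).continuous.comp (γ x).continuous)⟩ with hη₀
    have h1 := hvar x hx.1.1 (Y j x)
    have h2 := flowResidualDeriv_eq_zero Yc Y' hYd ((a x).1, (a x).2, γ x) (hres _ hx.1.1)
      (fun t i k => sub_eq_zero.1 (hball _ (hγρ t) i k)) j η₀ (fun t => rfl)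
    rw [hAY] at h1
    -- Both the derivative of `γ` along `Yⱼ` and `η₀` solve the linearized equation with the data
    -- `(-eⱼ, Yⱼ)`. By uniqueness they agree, and `η₀` vanishes at `t = 1`.
    have h3 := hinj (a x) hx.1.1 (fderiv ℝ γ x (Y j x) - η₀) (by
      rw [← sub_eq_zero.2 (h1.trans h2.symm), ← map_sub]
      congr 1
      refine Prod.ext ?_ (Prod.ext ?_ rfl)
      · simp
      · simp [Yc, ha])
    rw [(hev 1 x hx.1.1).fderiv]
    have h4 : fderiv ℝ γ x (Y j x) = η₀ := sub_eq_zero.1 h3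
    simp [h4, hη₀]
  · intro v
    have h1 := hvar 0 h0s₁ v
    rw [flowResidualDeriv_apply, sub_sub, sub_eq_zero] at h1
    rw [(hev 1 0 h0s₁).fderiv]
    change fderiv ℝ γ 0 v 1 = _
    simp only at h1
    -- At `x = 0` the path is constantly `0` and the parameters vanish, so the integrand is
    -- constant.
    have h2 : (∑ i, ((a 0).1 i • pointwiseApply unitInterval E E ((Y' i).comp (γ 0)) (fderiv ℝ γ 0 v)
        + (A 0 v).1 i • (Yc i).comp (γ 0))) = pathConst E (-∑ i, fderiv ℝ (ψ i) 0 v • Y i 0) := by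
      ext t
      simp [ha0, hγ0, hA, Yc]
    rw [h1, h2]
    simp [pathIntegral_apply, pathExtend, hA, sub_eq_add_neg]

end FirstIntegrals

/-! ### First integrals of involutive distributions -/

section Frame

variable {E : Type} [NormedAddCommGroup E] [NormedSpace ℝ E] {ι : Type}

/-- The matrix with entries `dφᵢ(gⱼ)`. -/
def pairingMatrix (φ : ι → E → ℝ) (g : ι → E → E) (x : E) : Matrix ι ι ℝ :=
  Matrix.of fun i j => fderiv ℝ (φ i) x (g j x)

theorem contDiff_pairingMatrix {φ : ι → E → ℝ} {g : ι → E → E} (hφ : ∀ i, ContDiff ℝ ∞ (φ i))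
    (hg : ∀ i, ContDiff ℝ ∞ (g i)) (i j : ι) :
    ContDiff ℝ ∞ fun x => pairingMatrix φ g x i j :=
  ((hφ i).fderiv_right (m := ∞) (by simp)).clm_apply (hg j)

variable [Fintype ι] [DecidableEq ι]

theorem contDiff_det {M : E → Matrix ι ι ℝ} (hM : ∀ i j, ContDiff ℝ ∞ fun x => M x i j) :
    ContDiff ℝ ∞ fun x => (M x).det := by
  simp only [Matrix.det_apply']
  exact ContDiff.sum fun σ _ => contDiff_const.mul (contDiff_prod fun i _ => hM _ _)

theorem contDiff_adjugate {M : E → Matrix ι ι ℝ} (hM : ∀ i j, ContDiff ℝ ∞ fun x => M x i j)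
    (i j : ι) : ContDiff ℝ ∞ fun x => (M x).adjugate i j := by
  simp only [Matrix.adjugate_apply]
  refine contDiff_det fun k l => ?_
  by_cases hk : k = j
  · subst hk
    simpa using contDiff_const
  · simpa [Matrix.updateRow_ne hk] using hM k l

/-- The coefficients of `v` in the `gⱼ` form a kernel vector of the nonsingular pairing matrix. -/
theorem eq_zero_of_mem_span_of_pairing {φ : ι → E → ℝ} {g : ι → E → E} {x v : E}
    (hdet : (pairingMatrix φ g x).det ≠ 0) (hv : v ∈ Submodule.span ℝ (range fun j => g j x))
    (h0 : ∀ i, fderiv ℝ (φ i) x v = 0) : v = 0 := by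
  obtain ⟨c, rfl⟩ := (Submodule.mem_span_range_iff_exists_fun ℝ).1 hv
  have h1 : pairingMatrix φ g x *ᵥ c = 0 := by
    funext i
    have := h0 i
    simp only [map_sum, map_smul, smul_eq_mul] at this
    simpa [Matrix.mulVec, dotProduct, pairingMatrix, mul_comm] using this
  have h2 := Matrix.eq_zero_of_mulVec_eq_zero hdet h1
  simp [h2]

/-- Near `0` the fields are `Yⱼ = ∑ₖ (M⁻¹)ₖⱼ gₖ`, with `M` the pairing matrix. A bump function
supported where `det M ≠ 0` makes them globally smooth, as the flow construction requires. -/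
theorem exists_dual_frame [FiniteDimensional ℝ E] [HasContDiffBump E] {φ : ι → E → ℝ}
    {g : ι → E → E} (hφ : ∀ i, ContDiff ℝ ∞ (φ i)) (hg : ∀ i, ContDiff ℝ ∞ (g i))
    (hdet : (pairingMatrix φ g 0).det ≠ 0) :
    ∃ Y : ι → E → E, (∀ i, ContDiff ℝ ∞ (Y i)) ∧
      (∀ x i, Y i x ∈ Submodule.span ℝ (range fun j => g j x)) ∧
      ∀ᶠ x in 𝓝 0, ∀ i j, fderiv ℝ (φ i) x (Y j x) = if i = j then 1 else 0 := by
  have hM := contDiff_pairingMatrix hφ hg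
  have hd := contDiff_det hM
  have hopen : IsOpen {x | (pairingMatrix φ g x).det ≠ 0} :=
    isOpen_ne_fun hd.continuous continuous_const
  obtain ⟨ρ, hρ, hball⟩ := Metric.isOpen_iff.1 hopen 0 hdet
  let χ : ContDiffBump (0 : E) := ⟨ρ / 4, ρ / 2, by positivity, by linarith⟩
  have hχ : tsupport χ ⊆ {x | (pairingMatrix φ g x).det ≠ 0} := by
    rw [χ.tsupport_eq]
    exact (Metric.closedBall_subset_ball (by change ρ / 2 < ρ; linarith)).trans hball
  have hcoef : ∀ k j, ContDiff ℝ ∞ fun x => χ x * (pairingMatrix φ g x)⁻¹ k j := by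
    intro k j
    refine contDiff_iff_contDiffAt.2 fun x => ?_
    by_cases hx : x ∈ tsupport χ
    · refine χ.contDiff.contDiffAt.mul ?_
      have : (fun x => (pairingMatrix φ g x)⁻¹ k j) =
          fun x => ((pairingMatrix φ g x).det)⁻¹ * (pairingMatrix φ g x).adjugate k j := by
        funext y
        simp [Matrix.inv_def]
      rw [this]
      exact (hd.contDiffAt.inv (hχ hx)).mul (contDiff_adjugate hM k j).contDiffAt
    · have h0 : (fun x => χ x * (pairingMatrix φ g x)⁻¹ k j) =ᶠ[𝓝 x] fun _ => 0 := by
        filter_upwards [(isClosed_tsupport χ).isOpen_compl.mem_nhds hx] with y hy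
        rw [image_eq_zero_of_notMem_tsupport hy, zero_mul]
      exact contDiffAt_const.congr_of_eventuallyEq h0
  refine ⟨fun j x => ∑ k, (χ x * (pairingMatrix φ g x)⁻¹ k j) • g k x, fun j =>
    ContDiff.sum fun k _ => (hcoef k j).smul (hg k), fun x j => ?_, ?_⟩
  · exact Submodule.sum_mem _ fun k _ => Submodule.smul_mem _ _ (Submodule.subset_span ⟨k, rfl⟩)
  · filter_upwards [χ.eventuallyEq_one, hopen.mem_nhds hdet] with x hx1 hx2 i j
    have hx1' : χ x = 1 := hx1
    have h1 : (pairingMatrix φ g x * (pairingMatrix φ g x)⁻¹) i j = if i = j then 1 else 0 := by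
      rw [Matrix.mul_nonsing_inv _ (isUnit_iff_ne_zero.2 hx2), Matrix.one_apply]
    rw [← h1, Matrix.mul_apply]
    simp [hx1', pairingMatrix, mul_comm]

end Frame

/-- An involutive distribution spanned by fields `gⱼ` for which the matrix `dψᵢ(gⱼ)` is
nonsingular at `0` admits a smooth local map constant along the `gⱼ` whose derivative at `0` is
the identity on the common kernel of the `dψᵢ`. -/
theorem InvolutiveOn.exists_projection {n : ℕ} {ι : Type} [Fintype ι] [DecidableEq ι]
    {g : ι → EuclideanSpace ℝ (Fin n) → EuclideanSpace ℝ (Fin n)}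
    {ψ : ι → EuclideanSpace ℝ (Fin n) → ℝ} {W : Set (EuclideanSpace ℝ (Fin n))}
    (hinv : InvolutiveOn (fun x => Submodule.span ℝ (range fun j => g j x)) W)
    (hW : W ∈ 𝓝 0) (hg : ∀ i, ContDiff ℝ ∞ (g i)) (hψ : ∀ i, ContDiff ℝ ∞ (ψ i))
    (hψ0 : ∀ i, ψ i 0 = 0) (hdet : (pairingMatrix ψ g 0).det ≠ 0) :
    ∃ (π : EuclideanSpace ℝ (Fin n) → EuclideanSpace ℝ (Fin n))
      (s : Set (EuclideanSpace ℝ (Fin n))), IsOpen s ∧ 0 ∈ s ∧ ContDiffOn ℝ ∞ π s ∧ π 0 = 0 ∧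
      (∀ x ∈ s, ∀ j, fderiv ℝ π x (g j x) = 0) ∧
      ∀ v, (∀ i, fderiv ℝ (ψ i) 0 v = 0) → fderiv ℝ π 0 v = v := by
  obtain ⟨Y, hY, hYg, hdual⟩ := exists_dual_frame hψ hg hdet
  have hdet' : ∀ᶠ x in 𝓝 0, (pairingMatrix ψ g x).det ≠ 0 :=
    (contDiff_det (contDiff_pairingMatrix hψ hg)).continuous.continuousAt.eventually_ne hdet
  -- The bracket lies in the distribution, and `dψₖ` of it is a difference of derivatives of the
  -- locally constant functions `dψₖ(Yₗ)`.
  have hcomm : ∀ᶠ x in 𝓝 0, ∀ i j, VectorField.lieBracket ℝ (Y i) (Y j) x = 0 := by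
    filter_upwards [hdual.eventually_nhds, hdet', hW] with x hx hdx hxW i j
    refine eq_zero_of_mem_span_of_pairing hdx (hinv (Y i) (Y j) (hY i).contDiffOn
      (hY j).contDiffOn (fun y _ => hYg y i) (fun y _ => hYg y j) x hxW) fun k => ?_
    have hconst : ∀ l, fderiv ℝ (fun y => fderiv ℝ (ψ k) y (Y l y)) x = 0 := by
      intro l
      have : (fun y => fderiv ℝ (ψ k) y (Y l y)) =ᶠ[𝓝 x] fun _ => if k = l then 1 else 0 :=
        hx.mono fun y hy => hy k l
      rw [this.fderiv_eq]
      simp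
    rw [VectorField.fderiv_apply_lieBracket (n := ∞) (hψ k).contDiffAt
      (by rw [minSmoothness_of_isRCLikeNormedField]; exact WithTop.coe_le_coe.2 (le_top : (2 : ℕ∞) ≤ ⊤))
      ((hY j).differentiable (by simp) x) ((hY i).differentiable (by simp) x), hconst, hconst]
    simp
  obtain ⟨π, s, hs, h0s, hπ, hπ0, hπY, hπd⟩ :=
    exists_projection_of_commuting Y hY ψ hψ hψ0 hcomm hdual
  refine ⟨π, s ∩ interior {x | (∀ i j, fderiv ℝ (ψ i) x (Y j x) = if i = j then 1 else 0) ∧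
    (pairingMatrix ψ g x).det ≠ 0}, hs.inter isOpen_interior,
    ⟨h0s, mem_interior_iff_mem_nhds.2 (hdual.and hdet')⟩, hπ.mono inter_subset_left, hπ0, ?_, ?_⟩
  · intro x hx j
    have hx' := interior_subset hx.2
    -- The expansion of `gⱼ` in the dual frame transfers the constancy of `π` from the `Yₖ` to the
    -- `gⱼ`.
    have h1 : g j x - ∑ k, fderiv ℝ (ψ k) x (g j x) • Y k x = 0 := by
      refine eq_zero_of_mem_span_of_pairing hx'.2 (Submodule.sub_mem _
        (Submodule.subset_span ⟨j, rfl⟩) (Submodule.sum_mem _ fun k _ =>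
          Submodule.smul_mem _ _ (hYg x k))) fun i => ?_
      simp [hx'.1]
    rw [sub_eq_zero.1 h1, map_sum]
    exact Finset.sum_eq_zero fun k _ => by rw [map_smul, hπY x hx.1 k, smul_zero]
  · intro v hv
    rw [hπd v]
    simp [hv]

/-! ### Existence of the normal form -/

theorem ContinuousLinearMap.apply_fderiv {E F G : Type*} [NormedAddCommGroup E] [NormedSpace ℝ E]
    [NormedAddCommGroup F] [NormedSpace ℝ F] [NormedAddCommGroup G] [NormedSpace ℝ G]
    (L : F →L[ℝ] G) {f : E → F} {x : E} (hf : DifferentiableAt ℝ f x) (v : E) :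
    L (fderiv ℝ f x v) = fderiv ℝ (fun y => L (f y)) x v := by
  have h : HasFDerivAt (fun y => L (f y)) (L.comp (fderiv ℝ f x)) x :=
    L.hasFDerivAt.comp x hf.hasFDerivAt
  rw [h.fderiv]
  rfl

theorem ContDiff.lieDeriv {n : ℕ} {X : EuclideanSpace ℝ (Fin n) → EuclideanSpace ℝ (Fin n)}
    {φ : EuclideanSpace ℝ (Fin n) → ℝ} (hX : ContDiff ℝ ∞ X) (hφ : ContDiff ℝ ∞ φ) :
    ContDiff ℝ ∞ (lieDeriv X φ) :=
  (hφ.fderiv_right (m := ∞) (by simp)).clm_apply hX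

namespace AffineSystem

variable {n p : ℕ} (S : AffineSystem n p)

theorem lieOut_succ (k : ℕ) (i : Fin p) : S.lieOut (k + 1) i = lieDeriv S.f (S.lieOut k i) :=
  Function.iterate_succ_apply' _ _ _

variable {S}

theorem contDiff_lieOut (hf : ContDiff ℝ ∞ S.f) (hh : ContDiff ℝ ∞ S.h) (k : ℕ) (i : Fin p) :
    ContDiff ℝ ∞ (S.lieOut k i) := by
  induction k with
  | zero => exact (contDiff_euclidean.1 hh) i
  | succ k ih => rw [lieOut_succ]; exact hf.lieDeriv ih

theorem lieOut_apply_zero (hf0 : S.f 0 = 0) (hh0 : S.h 0 = 0) (k : ℕ) (i : Fin p) :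
    S.lieOut k i 0 = 0 := by
  cases k with
  | zero => simp [lieOut, hh0]
  | succ k => rw [lieOut_succ, lieDeriv, hf0, map_zero]

/-- At an equilibrium the differential of `L_f φ` is `dφ ∘ Df`. -/
theorem fderiv_lieOut_succ (hf : ContDiff ℝ ∞ S.f) (hh : ContDiff ℝ ∞ S.h) (hf0 : S.f 0 = 0)
    (k : ℕ) (i : Fin p) (v : EuclideanSpace ℝ (Fin n)) :
    fderiv ℝ (S.lieOut (k + 1) i) 0 v = fderiv ℝ (S.lieOut k i) 0 (fderiv ℝ S.f 0 v) := by
  have h1 : HasFDerivAt (fderiv ℝ (S.lieOut k i)) (fderiv ℝ (fderiv ℝ (S.lieOut k i)) 0) 0 :=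
    (((contDiff_lieOut hf hh k i).fderiv_right (m := ∞) (by simp)).differentiable
      (by simp) 0).hasFDerivAt
  have h2 := h1.clm_apply (hf.differentiable (by simp) 0).hasFDerivAt
  have h3 : S.lieOut (k + 1) i = fun y => fderiv ℝ (S.lieOut k i) y (S.f y) := lieOut_succ S k i
  rw [h3, h2.fderiv]
  simp [hf0]

theorem fderiv_dyn {F : Type*} [NormedAddCommGroup F] [NormedSpace ℝ F]
    (φ : EuclideanSpace ℝ (Fin n) → F) (x : EuclideanSpace ℝ (Fin n))
    (u : EuclideanSpace ℝ (Fin p)) :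
    fderiv ℝ φ x (S.dyn x u) = fderiv ℝ φ x (S.f x) + ∑ j, u j • fderiv ℝ φ x (S.g j x) := by
  simp [dyn]

theorem fderiv_lieOut_dyn (k : ℕ) (i : Fin p) (x : EuclideanSpace ℝ (Fin n))
    (u : EuclideanSpace ℝ (Fin p)) :
    fderiv ℝ (S.lieOut k i) x (S.dyn x u) =
      S.lieOut (k + 1) i x + ∑ j, lieDeriv (S.g j) (S.lieOut k i) x * u j := by
  rw [fderiv_dyn, lieOut_succ]
  simp [lieDeriv, mul_comm]

variable {r : Fin p → ℕ}

/-- The differentials of the outputs and of the `L_f hᵢ` with `rᵢ = 2` are independent. -/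
theorem HasVectorRelativeDegree.exists_fderiv_eq (hf : ContDiff ℝ ∞ S.f) (hh : ContDiff ℝ ∞ S.h)
    (hf0 : S.f 0 = 0) (hdeg : S.HasVectorRelativeDegree r 0) (α β : Fin p → ℝ) :
    ∃ v, (∀ i, fderiv ℝ (S.lieOut (r i - 1) i) 0 v = α i) ∧
      ∀ i, r i = 2 → fderiv ℝ (S.lieOut 0 i) 0 v = β i := by
  have hsolve : ∀ c : Fin p → ℝ, ∃ μ : Fin p → ℝ,
      ∀ i, fderiv ℝ (S.lieOut (r i - 1) i) 0 (∑ j, μ j • S.g j 0) = c i := by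
    intro c
    refine ⟨(S.decoupling r 0)⁻¹ *ᵥ c, fun i => ?_⟩
    have h1 : S.decoupling r 0 *ᵥ ((S.decoupling r 0)⁻¹ *ᵥ c) = c := by
      rw [Matrix.mulVec_mulVec, Matrix.mul_nonsing_inv _ hdeg.nonsingular, Matrix.one_mulVec]
    conv_rhs => rw [← h1]
    simp only [map_sum, map_smul, smul_eq_mul]
    exact Finset.sum_congr rfl fun j _ => mul_comm _ _
  -- Since `f(0) = 0`, the vector `w = Df(0) ∑ νⱼ gʲ` has `dhᵢ(w) = d(L_f hᵢ)(∑ νⱼ gʲ) = βᵢ` when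
  -- `rᵢ = 2`. Adding `∑ μⱼ gʲ` then adjusts the values of the `dψᵢ` without affecting those `dhᵢ`,
  -- which annihilate every `gʲ`.
  obtain ⟨ν, hν⟩ := hsolve β
  set w := fderiv ℝ S.f 0 (∑ j, ν j • S.g j 0) with hw
  obtain ⟨μ, hμ⟩ := hsolve fun i => α i - fderiv ℝ (S.lieOut (r i - 1) i) 0 w
  refine ⟨∑ j, μ j • S.g j 0 + w, fun i => by rw [map_add, hμ]; ring, fun i hi => ?_⟩
  have h0 : ∀ j, fderiv ℝ (S.lieOut 0 i) 0 (S.g j 0) = 0 := fun j =>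
    hdeg.eventually_eq_zero.self_of_nhds i j 0 (by omega)
  have h1 := hν i
  rw [hi, show 2 - 1 = 0 + 1 from rfl, fderiv_lieOut_succ hf hh hf0] at h1
  have h2 : fderiv ℝ (S.lieOut 0 i) 0 (∑ j, μ j • S.g j 0) = 0 := by simp [h0]
  rw [map_add, h2, zero_add]
  exact h1

/-- The output coordinates `(ξ₁, ξ₂, ξ₃)`. -/
def outputCoordinates (S : AffineSystem n p) (r : Fin p → ℕ) (x : EuclideanSpace ℝ (Fin n)) :
    EuclideanSpace ℝ {i : Fin p // r i = 1} ×
      EuclideanSpace ℝ {i : Fin p // r i = 2} × EuclideanSpace ℝ {i : Fin p // r i = 2} :=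
  (WithLp.toLp 2 fun i => S.lieOut 0 i x, WithLp.toLp 2 fun i => S.lieOut 0 i x,
    WithLp.toLp 2 fun i => S.lieOut 1 i x)

theorem contDiff_outputCoordinates (hf : ContDiff ℝ ∞ S.f) (hh : ContDiff ℝ ∞ S.h) :
    ContDiff ℝ ∞ (S.outputCoordinates r) :=
  (contDiff_euclidean.2 fun i => contDiff_lieOut hf hh 0 i.1).prodMk
    ((contDiff_euclidean.2 fun i => contDiff_lieOut hf hh 0 i.1).prodMk
      (contDiff_euclidean.2 fun i => contDiff_lieOut hf hh 1 i.1))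

theorem fderiv_outputCoordinates (hf : ContDiff ℝ ∞ S.f) (hh : ContDiff ℝ ∞ S.h)
    (x v : EuclideanSpace ℝ (Fin n)) :
    fderiv ℝ (S.outputCoordinates r) x v =
      (WithLp.toLp 2 fun i : {i : Fin p // r i = 1} => fderiv ℝ (S.lieOut 0 i) x v,
        WithLp.toLp 2 fun i : {i : Fin p // r i = 2} => fderiv ℝ (S.lieOut 0 i) x v,
        WithLp.toLp 2 fun i : {i : Fin p // r i = 2} => fderiv ℝ (S.lieOut 1 i) x v) := by
  have hd : DifferentiableAt ℝ (S.outputCoordinates r) x :=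
    (contDiff_outputCoordinates hf hh).differentiable (by simp) x
  refine Prod.ext ?_ (Prod.ext ?_ ?_) <;> ext i
  · exact ((EuclideanSpace.proj i : EuclideanSpace ℝ {i : Fin p // r i = 1} →L[ℝ] ℝ).comp
      (ContinuousLinearMap.fst ℝ _ _)).apply_fderiv hd v
  · exact ((EuclideanSpace.proj i : EuclideanSpace ℝ {i : Fin p // r i = 2} →L[ℝ] ℝ).comp
      ((ContinuousLinearMap.fst ℝ _ _).comp (ContinuousLinearMap.snd ℝ _ _))).apply_fderiv hd v
  · exact ((EuclideanSpace.proj i : EuclideanSpace ℝ {i : Fin p // r i = 2} →L[ℝ] ℝ).comp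
      ((ContinuousLinearMap.snd ℝ _ _).comp (ContinuousLinearMap.snd ℝ _ _))).apply_fderiv hd v

/-- With `K = ker dξ(0)`, the coordinates are `(P π(x), ξ(x))`, where `P` is the orthogonal
projection to `K` read in an orthonormal basis. Their derivative at `0` is bijective because `dξ(0)`
is onto and `dπ(0)` is the identity on `K`. -/
theorem HasVectorRelativeDegree.nonempty_normalForm (hf : ContDiff ℝ ∞ S.f)
    (hg : ∀ j, ContDiff ℝ ∞ (S.g j)) (hh : ContDiff ℝ ∞ S.h) (hf0 : S.f 0 = 0) (hh0 : S.h 0 = 0)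
    (hr : ∀ i, 1 ≤ r i ∧ r i ≤ 2) (hdeg : S.HasVectorRelativeDegree r 0)
    {W : Set (EuclideanSpace ℝ (Fin n))} (hW : W ∈ 𝓝 0)
    (hinv : InvolutiveOn S.inputDistribution W) : Nonempty (NormalForm S r) := by
  obtain ⟨π, s, hs, h0s, hπ, hπ0, hπg, hπd⟩ := InvolutiveOn.exists_projection
    (ψ := fun i => S.lieOut (r i - 1) i) hinv hW hg
    (fun i => contDiff_lieOut hf hh _ i) (fun i => lieOut_apply_zero hf0 hh0 _ i)
    (isUnit_iff_ne_zero.1 hdeg.nonsingular)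
  have hr12 : ∀ i, r i = 1 ∨ r i = 2 := fun i => by have := hr i; omega
  set ξ := S.outputCoordinates r with hξ
  have hξs : ContDiff ℝ ∞ ξ := contDiff_outputCoordinates hf hh
  have hξd := fderiv_outputCoordinates (r := r) hf hh
  set T := fderiv ℝ ξ 0 with hT
  have hTsurj : Function.Surjective T := by
    intro τ
    obtain ⟨v, hv1, hv2⟩ := hdeg.exists_fderiv_eq hf hh hf0
      (fun i => if hi : r i = 1 then τ.1 ⟨i, hi⟩ else if hi : r i = 2 then τ.2.2 ⟨i, hi⟩ else 0)
      (fun i => if hi : r i = 2 then τ.2.1 ⟨i, hi⟩ else 0)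
    refine ⟨v, ?_⟩
    rw [hT, hξd]
    refine Prod.ext ?_ (Prod.ext ?_ ?_) <;> ext ⟨i, hi⟩
    · simpa [hi] using hv1 i
    · simpa [hi] using hv2 i hi
    · simpa [hi] using hv1 i
  -- Each `ψᵢ` is an entry of `ξ₁` or of `ξ₃`, so `ker dξ(0)` lies in the common kernel of the
  -- `dψᵢ`.
  have hTψ : ∀ v, T v = 0 → ∀ i, fderiv ℝ (S.lieOut (r i - 1) i) 0 v = 0 := by
    intro v hv i
    rw [hT, hξd] at hv
    rcases hr12 i with hi | hi
    · have h1 := congrArg (fun τ : EuclideanSpace ℝ {i : Fin p // r i = 1} ×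
        EuclideanSpace ℝ {i : Fin p // r i = 2} × EuclideanSpace ℝ {i : Fin p // r i = 2} =>
        τ.1 ⟨i, hi⟩) hv
      simpa [hi] using h1
    · have h1 := congrArg (fun τ : EuclideanSpace ℝ {i : Fin p // r i = 1} ×
        EuclideanSpace ℝ {i : Fin p // r i = 2} × EuclideanSpace ℝ {i : Fin p // r i = 2} =>
        τ.2.2 ⟨i, hi⟩) hv
      simpa [hi] using h1
  set K : Submodule ℝ (EuclideanSpace ℝ (Fin n)) := LinearMap.ker T.toLinearMap with hK
  let R : K ≃ₗᵢ[ℝ] EuclideanSpace ℝ (Fin (Module.finrank ℝ K)) := (stdOrthonormalBasis ℝ K).repr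
  let P : EuclideanSpace ℝ (Fin n) →L[ℝ] EuclideanSpace ℝ (Fin (Module.finrank ℝ K)) :=
    (R.toContinuousLinearEquiv : K →L[ℝ] _).comp K.orthogonalProjectionOnto
  have hPK : ∀ v : K, P v = R v := fun v => by simp [P]
  set Φ : EuclideanSpace ℝ (Fin n) → NormalState (Module.finrank ℝ K) r :=
    fun x => (P (π x), ξ x) with hΦ
  -- On this smaller neighbourhood `L_{gʲ} hᵢ = 0` for `rᵢ = 2`, which makes `ξ̇₂ = ξ₃` free of the
  -- input.
  set s' := s ∩ interior {x | ∀ i j, ∀ k : ℕ, k + 1 < r i →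
    lieDeriv (S.g j) (S.lieOut k i) x = 0} with hs'
  have hs'n : s' ∈ 𝓝 0 := Filter.inter_mem (hs.mem_nhds h0s)
    (interior_mem_nhds.2 hdeg.eventually_eq_zero)
  have hπx : ∀ x ∈ s, HasFDerivAt π (fderiv ℝ π x) x := fun x hx =>
    ((hπ.contDiffAt (hs.mem_nhds hx)).differentiableAt (by simp)).hasFDerivAt
  have hΦd : ∀ x ∈ s, HasFDerivAt Φ ((P.comp (fderiv ℝ π x)).prod (fderiv ℝ ξ x)) x :=
    fun x hx => (P.hasFDerivAt.comp x (hπx x hx)).prodMk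
      (hξs.differentiable (by simp) x).hasFDerivAt
  have hinj : LinearMap.ker ((P.comp (fderiv ℝ π 0)).prod T).toLinearMap = ⊥ := by
    rw [LinearMap.ker_eq_bot']
    intro v hv
    have h1 : P (fderiv ℝ π 0 v) = 0 := congrArg Prod.fst hv
    have h2 : T v = 0 := congrArg Prod.snd hv
    rw [hπd v (hTψ v h2)] at h1
    have h3 : R ⟨v, h2⟩ = 0 := (hPK ⟨v, h2⟩).symm.trans h1
    exact congrArg Subtype.val ((map_eq_zero_iff R R.injective).1 h3)
  have hsurj : LinearMap.range ((P.comp (fderiv ℝ π 0)).prod T).toLinearMap = ⊤ := by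
    rw [LinearMap.range_eq_top]
    rintro ⟨ζ, τ⟩
    obtain ⟨v, rfl⟩ := hTsurj τ
    -- A correction inside `K` adjusts `z` without changing the `ξ` component.
    set w : K := R.symm (ζ - P (fderiv ℝ π 0 v)) with hw
    have hTw : T w = 0 := w.2
    refine ⟨v + w, Prod.ext ?_ ?_⟩
    · change P (fderiv ℝ π 0 (v + w)) = ζ
      rw [map_add, map_add, hπd w (hTψ w hTw), hPK, hw]
      simp
    · change T (v + w) = T v
      rw [map_add, hTw, add_zero]
  obtain ⟨e, he, he0, hes, hec, hec'⟩ := exists_openPartialHomeomorph_contDiffOn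
    (f := Φ) (f' := ContinuousLinearEquiv.ofBijective _ hinj hsurj) hs'n
    ((ContDiffOn.continuousLinearMap_comp P (hπ.mono inter_subset_left)).prodMk hξs.contDiffOn)
    (hΦd 0 h0s)
  have hleft : ∀ x ∈ e.source, e.symm (Φ x) = x := fun x hx => by
    rw [← he]; exact e.left_inv hx
  refine ⟨⟨Module.finrank ℝ K, e, he0, ?_, hec, hec',
    fun q => P (fderiv ℝ π (e.symm q) (S.f (e.symm q))),
    fun q => WithLp.toLp 2 fun i => S.lieOut 1 i (e.symm q),
    fun q => Matrix.of fun i j => lieDeriv (S.g j) (S.lieOut 0 i) (e.symm q),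
    fun q => WithLp.toLp 2 fun i => S.lieOut 2 i (e.symm q),
    fun q => Matrix.of fun i j => lieDeriv (S.g j) (S.lieOut 1 i) (e.symm q),
    ?_, ?_, ?_, ?_, ?_, ?_, ?_⟩⟩
  · rw [he]
    refine Prod.ext (by simp [hΦ, hπ0]) (Prod.ext ?_ (Prod.ext ?_ ?_)) <;> ext i <;>
      exact lieOut_apply_zero hf0 hh0 _ _
  · intro x hx u
    have hxs := hes hx
    rw [he, hleft x hx, (hΦd x hxs.1).fderiv]
    refine Prod.ext ?_ ?_
    · change P (fderiv ℝ π x (S.dyn x u)) = _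
      rw [fderiv_dyn]
      simp [hπg x hxs.1]
    · change fderiv ℝ ξ x (S.dyn x u) = _
      rw [hξd]
      refine Prod.ext ?_ (Prod.ext ?_ ?_) <;> ext i <;>
        refine (fderiv_lieOut_dyn _ _ _ _).trans ?_
      · rfl
      · have h0 : ∀ j, lieDeriv (S.g j) (S.lieOut 0 i) x = 0 := fun j =>
          interior_subset hxs.2 i j 0 (by have := i.2; omega)
        simp [h0, hΦ, hξ, outputCoordinates]
      · rfl
  · intro x _ i
    rw [he]; rfl
  · intro x _ i
    rw [he]; rfl
  · intro x hx i
    rw [he, hleft x hx]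
  · intro x hx i
    rw [he, hleft x hx]
  · intro x hx i j
    rw [he, hleft x hx]
    rfl
  · intro x hx i j
    rw [he, hleft x hx]
    rfl

end AffineSystem

/-! ### Dissipativity of the closed loop -/

theorem sum_eq_sum_subtype_add_sum_subtype {p : ℕ} {r : Fin p → ℕ} (hr : ∀ i, r i = 1 ∨ r i = 2)
    (F : Fin p → ℝ) :
    ∑ i, F i = (∑ i : {i : Fin p // r i = 1}, F i) + ∑ i : {i : Fin p // r i = 2}, F i := by
  rw [← Finset.sum_subtype (Finset.univ.filter fun i => r i = 1) (by simp) F,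
    ← Finset.sum_subtype (Finset.univ.filter fun i => r i = 2) (by simp) F,
    Finset.sum_filter, Finset.sum_filter, ← Finset.sum_add_distrib]
  refine Finset.sum_congr rfl fun i _ => ?_
  rcases hr i with h | h <;> simp [h]

namespace NormalForm

variable {n p : ℕ} {S : AffineSystem n p} {r : Fin p → ℕ} (N : NormalForm S r)
  {V₁ : EuclideanSpace ℝ {i : Fin p // r i = 1} → ℝ}
  {V₂ : EuclideanSpace ℝ {i : Fin p // r i = 2} → ℝ} {lam : ℝ}

/-- The left side is the input term in the derivative of `L_f^{rᵢ-1} hᵢ`; the feedback is designed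
so that it cancels the drift `L_f^{rᵢ} hᵢ`. -/
theorem sum_decoupling_mul_feedback {x : EuclideanSpace ℝ (Fin n)}
    (hx : IsUnit (S.decoupling r x).det) (v : EuclideanSpace ℝ (Fin p)) (i : Fin p) :
    ∑ j, lieDeriv (S.g j) (S.lieOut (r i - 1) i) x * N.feedback V₁ V₂ lam x v j =
      v i - S.lieOut (r i) i x - N.shaping V₁ V₂ lam x i := by
  have h : S.decoupling r x *ᵥ (N.feedback V₁ V₂ lam x v).ofLp =
      fun i => v i - S.lieOut (r i) i x - N.shaping V₁ V₂ lam x i := by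
    rw [feedback, Matrix.mulVec_mulVec, Matrix.mul_nonsing_inv _ hx, Matrix.one_mulVec]
  exact congrFun h i

theorem fderiv_closedLoop_fst {x : EuclideanSpace ℝ (Fin n)} (hxs : x ∈ N.Φ.source)
    (hx : IsUnit (S.decoupling r x).det) (v : EuclideanSpace ℝ (Fin p))
    (i : {i : Fin p // r i = 1}) :
    (fderiv ℝ N.Φ x (N.closedLoop V₁ V₂ lam x v)).2.1 i = v i - gradient V₁ (N.ξ₁ x) i := by
  have h := N.sum_decoupling_mul_feedback (V₁ := V₁) (V₂ := V₂) (lam := lam) hx v i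
  rw [closedLoop, N.dynamics x hxs]
  simp only [i.2, shaping, dif_pos] at h
  simp only [PiLp.add_apply, Matrix.mulVec, dotProduct, N.b₁_eq x hxs, N.a₁_eq x hxs]
  linarith

theorem fderiv_closedLoop_snd {x : EuclideanSpace ℝ (Fin n)} (hxs : x ∈ N.Φ.source)
    (v : EuclideanSpace ℝ (Fin p)) :
    (fderiv ℝ N.Φ x (N.closedLoop V₁ V₂ lam x v)).2.2.1 = N.ξ₃ x := by
  rw [closedLoop, N.dynamics x hxs]
  rfl

theorem fderiv_closedLoop_thd {x : EuclideanSpace ℝ (Fin n)} (hxs : x ∈ N.Φ.source)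
    (hx : IsUnit (S.decoupling r x).det) (v : EuclideanSpace ℝ (Fin p))
    (i : {i : Fin p // r i = 2}) :
    (fderiv ℝ N.Φ x (N.closedLoop V₁ V₂ lam x v)).2.2.2 i =
      v i - gradient V₂ (N.ξ₂ x) i - lam * N.ξ₃ x i := by
  have h := N.sum_decoupling_mul_feedback (V₁ := V₁) (V₂ := V₂) (lam := lam) hx v i
  rw [closedLoop, N.dynamics x hxs]
  have h21 : ¬ (2 = 1) := by norm_num
  simp only [i.2, shaping, dif_pos, dif_neg h21] at h
  simp only [PiLp.add_apply, Matrix.mulVec, dotProduct, N.b₂_eq x hxs, N.a₂_eq x hxs]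
  linarith

theorem contDiffOn_storage (hV₁ : ContDiff ℝ 1 V₁) (hV₂ : ContDiff ℝ 1 V₂) :
    ContDiffOn ℝ 1 (N.storage V₁ V₂) N.Φ.source := by
  have hΦ : ContDiffOn ℝ 1 N.Φ N.Φ.source :=
    N.contDiffOn.of_le (by exact mod_cast (le_top : (1 : ℕ∞) ≤ ⊤))
  have h1 : ContDiffOn ℝ 1 N.ξ₁ N.Φ.source := hΦ.snd.fst
  have h2 : ContDiffOn ℝ 1 N.ξ₂ N.Φ.source := hΦ.snd.snd.fst
  have h3 : ContDiffOn ℝ 1 N.ξ₃ N.Φ.source := hΦ.snd.snd.snd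
  exact ((hV₁.comp_contDiffOn h1).add (hV₂.comp_contDiffOn h2)).add
    (contDiffOn_const.mul (h3.norm_sq ℝ))

theorem posSemidefOn_storage (hV₁ : PosSemidefOn V₁ univ) (hV₂ : PosSemidefOn V₂ univ)
    (U : Set (EuclideanSpace ℝ (Fin n))) : PosSemidefOn (N.storage V₁ V₂) U := by
  refine ⟨?_, fun x _ => ?_⟩
  · simp [storage, ξ₁, ξ₂, ξ₃, N.map_zero, hV₁.1, hV₂.1]
  · have h1 := hV₁.2 (N.ξ₁ x) (mem_univ _)
    have h2 := hV₂.2 (N.ξ₂ x) (mem_univ _)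
    have h3 : 0 ≤ 1 / 2 * ‖N.ξ₃ x‖ ^ 2 := by positivity
    unfold storage
    linarith

/-- The two bounds on `ε` come from separate blocks: entries with `rᵢ = 1` dissipate `ẏᵢ²`, those
with `rᵢ = 2` dissipate `λ ẏᵢ²`. -/
theorem isDissipativeStorageOn_storage (hr : ∀ i, r i = 1 ∨ r i = 2) (hh : ContDiff ℝ ∞ S.h)
    {U : Set (EuclideanSpace ℝ (Fin n))} (hU : U ⊆ N.Φ.source)
    (hdet : ∀ x ∈ U, IsUnit (S.decoupling r x).det)
    (hV₁ : ContDiff ℝ 1 V₁) (hV₁' : PosSemidefOn V₁ univ)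
    (hV₂ : ContDiff ℝ 1 V₂) (hV₂' : PosSemidefOn V₂ univ)
    {ε : ℝ} (hε : ε ≤ 1) (hεlam : ε ≤ lam) :
    IsDissipativeStorageOn (N.closedLoop V₁ V₂ lam) S.h U ε (N.storage V₁ V₂) := by
  refine ⟨(N.contDiffOn_storage hV₁ hV₂).mono hU, N.posSemidefOn_storage hV₁' hV₂' U, ?_⟩
  intro T v x htraj t ht
  have huniq := uniqueDiffOn_Ico (0 : ℝ) T t ht
  have hxs := hU (htraj.mem t ht)
  have hxd := hdet _ (htraj.mem t ht)
  have hx := htraj.hasDeriv t ht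
  set w := N.closedLoop V₁ V₂ lam (x t) (v t) with hw
  have hnhds := N.Φ.open_source.mem_nhds hxs
  have hΦ : HasFDerivAt N.Φ (fderiv ℝ N.Φ (x t)) (x t) :=
    ((N.contDiffOn.contDiffAt hnhds).differentiableAt (by simp)).hasFDerivAt
  have hΦx := hΦ.comp_hasDerivWithinAt t hx
  set d := fderiv ℝ N.Φ (x t) w with hd
  have h1 : HasDerivWithinAt (fun s => N.ξ₁ (x s)) d.2.1 (Ico 0 T) t := hΦx.snd.fst
  have h2 : HasDerivWithinAt (fun s => N.ξ₂ (x s)) d.2.2.1 (Ico 0 T) t := hΦx.snd.snd.fst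
  have h3 : HasDerivWithinAt (fun s => N.ξ₃ (x s)) d.2.2.2 (Ico 0 T) t := hΦx.snd.snd.snd
  have hVd : HasDerivWithinAt (fun s => N.storage V₁ V₂ (x s))
      (fderiv ℝ V₁ (N.ξ₁ (x t)) d.2.1 + fderiv ℝ V₂ (N.ξ₂ (x t)) d.2.2.1
        + 1 / 2 * (2 * inner ℝ (N.ξ₃ (x t)) d.2.2.2)) (Ico 0 T) t :=
    (((hV₁.differentiable (by simp) _).hasFDerivAt.comp_hasDerivWithinAt t h1).add
      ((hV₂.differentiable (by simp) _).hasFDerivAt.comp_hasDerivWithinAt t h2)).add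
      (h3.norm_sq.const_mul (1 / 2))
  have hyd : HasDerivWithinAt (fun s => S.h (x s)) (fderiv ℝ S.h (x t) w) (Ico 0 T) t :=
    (hh.differentiable (by simp) _).hasFDerivAt.comp_hasDerivWithinAt t hx
  set y := fderiv ℝ S.h (x t) w with hy
  have hyi : ∀ i, HasDerivWithinAt (fun s => S.h (x s) i) (y i) (Ico 0 T) t := fun i =>
    (EuclideanSpace.proj i : EuclideanSpace ℝ (Fin p) →L[ℝ] ℝ).hasFDerivAt.comp_hasDerivWithinAt
      t hyd
  -- The outputs equal the coordinates only on the source of `Φ`, so the derivatives are compared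
  -- along the trajectory, by uniqueness of the derivative within `[0, T)`.
  have hy1 : ∀ i : {i : Fin p // r i = 1}, y i = d.2.1 i := fun i => by
    have h : HasDerivWithinAt (fun s => N.ξ₁ (x s) i) (d.2.1 i) (Ico 0 T) t :=
      (EuclideanSpace.proj i :
        EuclideanSpace ℝ {i : Fin p // r i = 1} →L[ℝ] ℝ).hasFDerivAt.comp_hasDerivWithinAt t h1
    exact huniq.eq_deriv _ (hyi i) (h.congr_of_mem
      (fun s hs => N.output₁ _ (hU (htraj.mem s hs)) i) ht)
  have hy2 : ∀ i : {i : Fin p // r i = 2}, y i = d.2.2.1 i := fun i => by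
    have h : HasDerivWithinAt (fun s => N.ξ₂ (x s) i) (d.2.2.1 i) (Ico 0 T) t :=
      (EuclideanSpace.proj i :
        EuclideanSpace ℝ {i : Fin p // r i = 2} →L[ℝ] ℝ).hasFDerivAt.comp_hasDerivWithinAt t h2
    exact huniq.eq_deriv _ (hyi i) (h.congr_of_mem
      (fun s hs => N.output₂ _ (hU (htraj.mem s hs)) i) ht)
  rw [hVd.derivWithin huniq, hyd.derivWithin huniq]
  have hg1 : fderiv ℝ V₁ (N.ξ₁ (x t)) d.2.1 =
      ∑ i : {i : Fin p // r i = 1}, gradient V₁ (N.ξ₁ (x t)) i * y i := by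
    rw [← InnerProductSpace.toDual_symm_apply, PiLp.inner_apply]
    exact Finset.sum_congr rfl fun i _ => by rw [hy1]; exact mul_comm _ _
  have hg2 : fderiv ℝ V₂ (N.ξ₂ (x t)) d.2.2.1 =
      ∑ i : {i : Fin p // r i = 2}, gradient V₂ (N.ξ₂ (x t)) i * y i := by
    rw [← InnerProductSpace.toDual_symm_apply, PiLp.inner_apply]
    exact Finset.sum_congr rfl fun i _ => by rw [hy2]; exact mul_comm _ _
  have hξ3 : ∀ i : {i : Fin p // r i = 2}, N.ξ₃ (x t) i = y i := fun i => by
    rw [hy2, hd, hw, N.fderiv_closedLoop_snd hxs]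
  have hg3 : inner ℝ (N.ξ₃ (x t)) d.2.2.2 = ∑ i : {i : Fin p // r i = 2},
      y i * (v t i - gradient V₂ (N.ξ₂ (x t)) i - lam * y i) := by
    rw [PiLp.inner_apply]
    refine Finset.sum_congr rfl fun i _ => ?_
    rw [hd, hw, N.fderiv_closedLoop_thd hxs hxd, hξ3]
    exact mul_comm _ _
  have hvy : inner ℝ (v t) y = ∑ i, v t i * y i := by
    rw [PiLp.inner_apply]
    exact Finset.sum_congr rfl fun i _ => mul_comm _ _
  have hyy : ‖y‖ ^ 2 = ∑ i, y i ^ 2 := EuclideanSpace.real_norm_sq_eq y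
  -- Here `∇V₁ = v - ẏ` entrywise, so each summand is `v ẏ - ẏ²`, and `ε ≤ 1` suffices.
  have e1 : ∑ i : {i : Fin p // r i = 1}, gradient V₁ (N.ξ₁ (x t)) i * y i ≤
      ∑ i : {i : Fin p // r i = 1}, (v t i * y i - ε * y i ^ 2) := by
    refine Finset.sum_le_sum fun i _ => ?_
    have hyv : y i = v t i - gradient V₁ (N.ξ₁ (x t)) i := by
      rw [hy1, hd, hw, N.fderiv_closedLoop_fst hxs hxd]
    have hG : gradient V₁ (N.ξ₁ (x t)) i = v t i - y i := by linarith
    rw [hG]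
    nlinarith [mul_nonneg (sub_nonneg.2 hε) (sq_nonneg (y i))]
  -- The `∇V₂` terms cancel and leave `v ẏ - λ ẏ²`, so `ε ≤ λ` suffices.
  have e2 : (∑ i : {i : Fin p // r i = 2}, gradient V₂ (N.ξ₂ (x t)) i * y i) +
      ∑ i : {i : Fin p // r i = 2}, y i * (v t i - gradient V₂ (N.ξ₂ (x t)) i - lam * y i) ≤
      ∑ i : {i : Fin p // r i = 2}, (v t i * y i - ε * y i ^ 2) := by
    rw [← Finset.sum_add_distrib]
    refine Finset.sum_le_sum fun i _ => ?_
    nlinarith [mul_nonneg (sub_nonneg.2 hεlam) (sq_nonneg (y i))]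
  have hsplit := sum_eq_sum_subtype_add_sum_subtype hr fun i => v t i * y i - ε * y i ^ 2
  rw [Finset.sum_sub_distrib, ← Finset.mul_sum] at hsplit
  rw [hg1, hg2, hg3, hvy, hyy]
  linarith

end NormalForm

end

theorem theorem1 {n p : ℕ} (S : AffineSystem n p)
    (hf : ContDiff ℝ ∞ S.f) (hg : ∀ j, ContDiff ℝ ∞ (S.g j)) (hh : ContDiff ℝ ∞ S.h)
    (hLip : ∃ K, LipschitzWith K S.f) (hf0 : S.f 0 = 0) (hh0 : S.h 0 = 0)
    (r : Fin p → ℕ) (hr : ∀ i, 1 ≤ r i ∧ r i ≤ 2)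
    (hdeg : S.HasVectorRelativeDegree r 0)
    (W : Set (EuclideanSpace ℝ (Fin n))) (hW : IsOpen W) (hW0 : 0 ∈ W)
    (hinv : InvolutiveOn S.inputDistribution W) :
    ∃ (N : NormalForm S r) (U : Set (EuclideanSpace ℝ (Fin n))),
      IsOpen U ∧ 0 ∈ U ∧ U ⊆ N.Φ.source ∧ (∀ x ∈ U, IsUnit (S.decoupling r x).det) ∧
      ∀ (V₁ : EuclideanSpace ℝ {i : Fin p // r i = 1} → ℝ)
        (V₂ : EuclideanSpace ℝ {i : Fin p // r i = 2} → ℝ),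
        ContDiff ℝ 1 V₁ → PosSemidefOn V₁ univ → ContDiff ℝ 1 V₂ → PosSemidefOn V₂ univ →
        ∀ lam : ℝ,
          (0 ≤ lam →
            IsNonlinearNIOn (N.closedLoop V₁ V₂ lam) S.h U ∧
            IsNIStorageOn (N.closedLoop V₁ V₂ lam) S.h U (N.storage V₁ V₂)) ∧
          (0 < lam →
            IsNonlinearOSNIOn (N.closedLoop V₁ V₂ lam) S.h U ∧
            IsOSNIStorageOn (N.closedLoop V₁ V₂ lam) S.h U (N.storage V₁ V₂)) := by
  obtain ⟨N⟩ := hdeg.nonempty_normalForm hf hg hh hf0 hh0 hr (hW.mem_nhds hW0) hinv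
  have hr12 : ∀ i, r i = 1 ∨ r i = 2 := fun i => by have := hr i; omega
  have hdet : Continuous fun x => (S.decoupling r x).det :=
    (contDiff_det (contDiff_pairingMatrix (φ := fun i => S.lieOut (r i - 1) i)
      (fun i => AffineSystem.contDiff_lieOut hf hh _ i) hg)).continuous
  have hUdet : ∀ x ∈ N.Φ.source ∩ {x | (S.decoupling r x).det ≠ 0},
      IsUnit (S.decoupling r x).det := fun x hx => isUnit_iff_ne_zero.2 hx.2
  refine ⟨N, N.Φ.source ∩ {x | (S.decoupling r x).det ≠ 0},
    N.Φ.open_source.inter (isOpen_ne_fun hdet continuous_const),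
    ⟨N.zero_mem, isUnit_iff_ne_zero.1 hdeg.nonsingular⟩, inter_subset_left, hUdet, ?_⟩
  intro V₁ V₂ hV₁ hV₁' hV₂ hV₂' lam
  refine ⟨fun hlam => ?_, fun hlam => ?_⟩
  · have h : IsNIStorageOn (N.closedLoop V₁ V₂ lam) S.h _ (N.storage V₁ V₂) :=
      N.isDissipativeStorageOn_storage hr12 hh inter_subset_left hUdet hV₁ hV₁' hV₂ hV₂'
        zero_le_one hlam
    exact ⟨⟨_, h⟩, h⟩
  · have h : IsOSNIStorageOn (N.closedLoop V₁ V₂ lam) S.h _ (N.storage V₁ V₂) :=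
      -- This is the largest `ε` allowed by both blocks.
      ⟨min 1 lam, lt_min one_pos hlam, N.isDissipativeStorageOn_storage hr12 hh inter_subset_left
        hUdet hV₁ hV₁' hV₂ hV₂' (min_le_left _ _) (min_le_right _ _)⟩
    exact ⟨⟨_, h⟩, h⟩
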